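/- Let $\mathbb K\in\{\mathbb R,\mathbb C\}$, let $\mathcal A$ be a (non-empty) directed set, and let $(X_\alpha,d_\alpha,m_\alpha)_{\alpha\in\mathcal A}$ be a net of compact metric spaces with finite Borel measures converging to such a space $(X_\infty,d_\infty,m_\infty)$ in the measured Gromov–Hausdorff topology. That is, there are $\varepsilon_\alpha>0$ with $\varepsilon_\alpha\to0$ and $m_\alpha$-measurable maps $f_\alpha:X_\alpha\to X_\infty$ such that the $\varepsilon_\alpha$-neighbourhood of $f_\alpha(X_\alpha)$ is $X_\infty$, $|d_\alpha(x,y)-d_\infty(f_\alpha(x),f_\alpha(y))|\le\varepsilon_\alpha$ for all $x,y\in X_\alpha$, and $\int g\circ f_\alpha\,dm_\alpha\to\int g\,dm_\infty$ for all continuous $g:X_\infty\to\mathbb R$. Fix such maps $f_\alpha$ and write $L^2_\alpha=L^2(X_\alpha,m_\alpha;\mathbb K)$, $L^2_\infty=L^2(X_\infty,m_\infty;\mathbb K)$. *Convergence of vectors and operators.* A net $u_\alpha\in L^2_\alpha$ converges strongly to $u\in L^2_\infty$ if there is a net $(v_\beta)$ of continuous functions on $X_\infty$ with $v_\beta\to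 u$ in $L^2_\infty$ and $\lim_\beta\limsup_\alpha\|v_\beta\circ f_\alpha-u_\alpha\|_{L^2_\alpha}=0$. It converges weakly to $u$ if $\langle u_\alpha,v_\alpha\rangle\to\langle u,v\rangle$ whenever $v_\alpha\in L^2_\alpha$ converges strongly to $v\in L^2_\infty$. Bounded operators $B_\alpha$ on $L^2_\alpha$ converge compactly to a bounded operator $B$ on $L^2_\infty$ if $B_\alpha u_\alpha\to Bu$ strongly whenever $u_\alpha\to u$ weakly. *Spectral structures.* A spectral structure $\Sigma$ on a Hilbert space is a non-negative self-adjoint (possibly unbounded) operator $A$, together with its quadratic form, spectral measure, semigroup $e^{-tA}$ and resolvent $R_\zeta=(\zeta-A)^{-1}$, $\zeta\in\rho(A)$. Let $\Sigma_\alpha$ (operator $A_\alpha$, resolvent $R^\alpha_\zeta$) be spectral structures on $L^2_\alpha$ and $\Sigma$ (operator $A$, resolvent $R_\zeta$) one on $L^2_\infty$. We say that $\Sigma_\alpha\to\Sigma$ compactly if $R^\alpha_\zeta\to R_\zeta$ compactly for every $\zeta\in\mathbb K$ outside the union of the spectra of $A$ and of all the $A_\alpha$. **Theorem.** Suppose that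 $\Sigma_\alpha\to\Sigma$ compactly and that all the resolvents $R^\alpha_\zeta$ ($\alpha\in\mathcal A$, $\zeta\in\rho(A_\alpha)$) are compact operators. For $k\ge1$ let $\lambda_k$ (resp. $\lambda_k^\alpha$) be the $k$-th eigenvalue of $A$ (resp. $A_\alpha$), in increasing order and counted with multiplicity, with the value $+\infty$ if $k>\dim L^2_\infty$ (resp. $k>\dim L^2_\alpha$). Then for every $k\ge1$ $$\lim_\alpha\lambda_k^\alpha=\lambda_k\quad\text{in }[0,+\infty].$$ Furthermore, for every $\alpha$ let $\{\varphi_k^\alpha\mid 1\le k\le\dim L^2_\alpha\}$ ($k=1,2,\dots$ if the dimension is infinite) be an orthonormal basis of $L^2_\alpha$ such that $\varphi^\alpha_k$ is an eigenvector of $A_\alpha$ for $\lambda_k^\alpha$. Then there are a subnet of $\mathcal A$, the same for all $k$, and an orthonormal basis $\{\varphi_k\mid 1\le k\le\dim L^2_\infty\}$ of $L^2_\infty$ such that $\varphi_k$ is an eigenvector of $A$ for $\lambda_k$ and, for every $k\le\dim L^2_\infty$, the net $(\varphi_k^\alpha)_\alpha$ converges strongly to $\varphi_k$ along the subnet ($\varphi_k^\alpha$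 being defined for all large enough indices). -/

import Mathlib

open MeasureTheory Filter Topology
open scoped ENNReal

universe u

noncomputable section

namespace SpectralConvergence

/-! ### Measured Gromov-Hausdorff convergence of a net of compact metric measure spaces -/

/-- `φ : X → Y` is an `ε`-Hausdorff approximation: the `ε`-neighbourhood of its image is `Y`, and
it changes distances by at most `ε`. -/
def IsHausdorffApprox {X Y : Type*} [MetricSpace X] [MetricSpace Y] (ε : ℝ) (φ : X → Y) : Prop :=
  Metric.thickening ε (Set.range φ) = Set.univ ∧
    ∀ x y : X, |dist x y - dist (φ x) (φ y)| ≤ ε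

/-- The net `(X α, m α)` converges to `(Y, m₀)` for the measured Gromov-Hausdorff topology,
by means of the approximations `f α : X α → Y`. -/
def MeasuredGHConverges {ι : Type*} [Preorder ι] {X : ι → Type*} [∀ α, MetricSpace (X α)]
    [∀ α, MeasurableSpace (X α)] {Y : Type*} [MetricSpace Y] [MeasurableSpace Y]
    (m : ∀ α, Measure (X α)) (m₀ : Measure Y) (f : ∀ α, X α → Y) : Prop :=
  (∃ ε : ι → ℝ, (∀ α, 0 < ε α) ∧ Tendsto ε atTop (𝓝 0) ∧ ∀ α, IsHausdorffApprox (ε α) (f α)) ∧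
  (∀ α, AEMeasurable (f α) (m α)) ∧
  ∀ g : C(Y, ℝ), Tendsto (fun α => ∫ x, g (f α x) ∂(m α)) atTop (𝓝 (∫ y, g y ∂m₀))

/-! ### Convergence of vectors and of bounded operators along the spaces `L²(X α)` -/

section Nets

variable {𝕜 : Type*} [RCLike 𝕜] {ι : Type*} [Preorder ι] {X : ι → Type*}
  [∀ α, MeasurableSpace (X α)] {Y : Type*} [TopologicalSpace Y] [MeasurableSpace Y]
  {m : ∀ α, Measure (X α)} {m₀ : Measure Y}

/-- Strong convergence of `u α ∈ L²(X α)` to `w ∈ L²(Y)`: there is a net `v β` of continuous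
functions on `Y` with `v β → w` in `L²(Y)` and
`lim_β limsup_α ‖v β ∘ f α - u α‖_{L²(X α)} = 0`. -/
def StronglyConverges (f : ∀ α, X α → Y) (u : ∀ α, Lp 𝕜 2 (m α)) (w : Lp 𝕜 2 m₀) : Prop :=
  ∃ (κ : Type) (_ : Preorder κ) (_ : IsDirectedOrder κ) (_ : Nonempty κ) (v : κ → C(Y, 𝕜)),
    Tendsto (fun β => eLpNorm (fun y => v β y - w y) 2 m₀) atTop (𝓝 0) ∧
    Tendsto (fun β => limsup (fun α => eLpNorm (fun x => v β (f α x) - u α x) 2 (m α)) atTop)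
      atTop (𝓝 (0 : ℝ≥0∞))

/-- Weak convergence of `u α ∈ L²(X α)` to `w ∈ L²(Y)`: the scalar products with every strongly
convergent net converge. -/
def WeaklyConverges (f : ∀ α, X α → Y) (u : ∀ α, Lp 𝕜 2 (m α)) (w : Lp 𝕜 2 m₀) : Prop :=
  ∀ (v : ∀ α, Lp 𝕜 2 (m α)) (z : Lp 𝕜 2 m₀), StronglyConverges f v z →
    Tendsto (fun α => inner 𝕜 (u α) (v α)) atTop (𝓝 (inner 𝕜 w z))

/-- Compact convergence of bounded operators: weakly convergent nets are mapped to strongly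
convergent ones. -/
def CompactlyConverges (f : ∀ α, X α → Y) (B : ∀ α, Lp 𝕜 2 (m α) →L[𝕜] Lp 𝕜 2 (m α))
    (B₀ : Lp 𝕜 2 m₀ →L[𝕜] Lp 𝕜 2 m₀) : Prop :=
  ∀ (u : ∀ α, Lp 𝕜 2 (m α)) (w : Lp 𝕜 2 m₀), WeaklyConverges f u w →
    StronglyConverges f (fun α => B α (u α)) (B₀ w)

end Nets

/-! ### Spectral structures, resolvents and eigenvalues -/

section Operators

variable {𝕜 : Type*} [RCLike 𝕜] {H : Type*} [NormedAddCommGroup H] [InnerProductSpace 𝕜 H]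

/-- A spectral structure on a Hilbert space is given by a non-negative self-adjoint operator `A`,
possibly unbounded (self-adjointness includes the density of the domain). The closed quadratic
form `u ↦ ‖√A u‖²`, the spectral measure, the semigroup `exp (-t A)` and the resolvent of the
structure are those of `A`. -/
structure SpectralStructure (𝕜 : Type*) [RCLike 𝕜] (H : Type*) [NormedAddCommGroup H]
    [InnerProductSpace 𝕜 H] [CompleteSpace H] where
  /-- the operator -/
  A : H →ₗ.[𝕜] H
  selfAdjoint : IsSelfAdjoint A
  nonneg : ∀ x : A.domain, 0 ≤ RCLike.re (inner 𝕜 (A x) (x : H))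

/-- The bounded operator `R` is a two-sided inverse `(ζ - A)⁻¹ : H → D(A)`. -/
def IsResolventAt (A : H →ₗ.[𝕜] H) (ζ : 𝕜) (R : H →L[𝕜] H) : Prop :=
  (∀ u : H, ∃ h : R u ∈ A.domain, ζ • R u - A ⟨R u, h⟩ = u) ∧
    ∀ x : A.domain, R (ζ • (x : H) - A x) = x

/-- The resolvent set `ρ(A)`, the complement of the spectrum. -/
def resolventSet (A : H →ₗ.[𝕜] H) : Set 𝕜 := {ζ | ∃ R : H →L[𝕜] H, IsResolventAt A ζ R}

open Classical in
/-- The resolvent `R_ζ = (ζ - A)⁻¹` for `ζ ∈ ρ(A)` (and `0` for `ζ ∉ ρ(A)`). -/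
def resolvent (A : H →ₗ.[𝕜] H) (ζ : 𝕜) : H →L[𝕜] H :=
  if h : ∃ R : H →L[𝕜] H, IsResolventAt A ζ R then h.choose else 0

/-- `{x ∈ D(A) | A x = t x}`, as the set of `x` for which `(x, t x)` is in the graph of `A`. -/
def eigenspace (A : H →ₗ.[𝕜] H) (t : ℝ) : Submodule 𝕜 H :=
  A.graph.comap (LinearMap.id.prod ((t : 𝕜) • LinearMap.id))

/-- The `k`-th eigenvalue of `A` for `k = 1, 2, …`, in increasing order and counted with
multiplicity: the least `t` such that the eigenspaces for eigenvalues `≤ t` together have dimension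
at least `k`. It is `+∞` if `A` has fewer than `k` eigenvalues. -/
def kthEigenvalue (A : H →ₗ.[𝕜] H) (k : ℕ) : EReal :=
  sInf {s : EReal | ∃ t : ℝ, s = (t : EReal) ∧
    (k : Cardinal) ≤ Module.rank 𝕜 ↥(⨆ r : ℝ, ⨆ _ : r ≤ t, eigenspace A r)}

/-- The index set `{k | 1 ≤ k ≤ dim H}`; it is `{1, 2, …}` if `H` has infinite dimension. -/
def dimIndices (𝕜 : Type*) [RCLike 𝕜] (H : Type*) [NormedAddCommGroup H]
    [InnerProductSpace 𝕜 H] : Set ℕ :=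
  {k | 1 ≤ k ∧ (k : Cardinal) ≤ Module.rank 𝕜 H}

/-- `φ k`, for `1 ≤ k ≤ dim H`, is an orthonormal (Hilbert) basis of `H`, and `φ k` is an
eigenvector of `A` for its `k`-th eigenvalue. Nothing is said about `φ k` for other `k`. -/
def IsOrthonormalEigenbasis (A : H →ₗ.[𝕜] H) (φ : ℕ → H) : Prop :=
  Orthonormal 𝕜 (fun k : dimIndices 𝕜 H => φ k) ∧
  (Submodule.span 𝕜 (φ '' dimIndices 𝕜 H)).topologicalClosure = ⊤ ∧
  ∀ k ∈ dimIndices 𝕜 H, ∃ t : ℝ, kthEigenvalue A k = (t : EReal) ∧ φ k ∈ eigenspace A t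

end Operators

/-- Compact convergence of spectral structures: for every `ζ` outside the spectra of the limit
operator and of all the operators of the net, the resolvents at `ζ` converge compactly. -/
def SpectralStructure.CompactlyConverges {𝕜 : Type*} [RCLike 𝕜] {ι : Type*} [Preorder ι]
    {X : ι → Type*} [∀ α, MeasurableSpace (X α)] {Y : Type*} [TopologicalSpace Y]
    [MeasurableSpace Y] {m : ∀ α, Measure (X α)} {m₀ : Measure Y} (f : ∀ α, X α → Y)
    (S : ∀ α, SpectralStructure 𝕜 (Lp 𝕜 2 (m α))) (S₀ : SpectralStructure 𝕜 (Lp 𝕜 2 m₀)) : Prop :=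
  ∀ ζ : 𝕜, ζ ∈ resolventSet S₀.A → (∀ α, ζ ∈ resolventSet (S α).A) →
    SpectralConvergence.CompactlyConverges f (fun α => resolvent (S α).A ζ) (resolvent S₀.A ζ)

end SpectralConvergence

end

/-! Composition with `f α` sends continuous functions on `Y` into each L²_α, and ‖v ∘ f_α‖ → ‖v‖ for
each continuous v. Of the geometry only this, the density of C(Y) in L²_∞ and a positive null net
ε_α are used; the last gives the index set a countable scale, so that diagonal arguments work
(`exists_diagonal`). Since A ≥ 0, the point -1 lies in every resolvent set, and an eigenvalue t of A
corresponds to the eigenvalue -1/(1+t) of the contraction R = (-1 - A)⁻¹. Everything is deduced from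
the compact convergence of these R_α to R₀.

The difficulty is compactness along an ultrafilter U finer than the net, because the hypothesis
speaks only of nets converging weakly along the whole index set. `CompactLim.tendsto_zero` overcomes
it: a bounded net, weakly null along U, is split into an approximate projection onto a slowly
growing number of lifted basis vectors and a remainder. The remainder is weakly null along the whole
net, so R_α kills it in the limit. The projection mirrors a vector of the limit space, where R₀
sends bounded weakly null nets to null nets (`CompactLim.tendsto_zero_of_weak`). Hence R_α u_α has a
strong limit along U for all u_α in the unit balls (`CompactLim.exists_strong_limit`).

Along U, λ_k^α tends to some Λ_k in [0,+∞]. If Λ_k is finite, φ_k^α = -(1+λ_k^α) R_α φ_k^α converges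
strongly to an eigenvector for Λ_k, and orthonormality persists. A vector w orthogonal to all these
limits satisfies ‖R₀ w‖ ≤ ‖w‖/(1+B) for every B ≥ 0 (`norm_res_le_of_limit`, the Λ_k being unbounded
by compactness of R₀), so w = 0. A complete orthonormal system of eigenvectors with monotone
eigenvalues determines all the λ_k (`SpectralStructure.eigenbasis_of_monotone`), whence Λ_k = λ_k.
As this holds for every U, the whole net of eigenvalues converges; a single U yields one subnet for
all k. -/

namespace SpectralConvergence

/-! ### Strong convergence along a family of asymptotically isometric maps -/

/-- If a filter admits a positive function tending to `0`, then countably many eventual properties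
hold along a diagonal tending to infinity. -/
theorem exists_diagonal {ι : Type*} {F : Filter ι} {ε : ι → ℝ} (hε : ∀ α, 0 < ε α)
    (hε0 : Tendsto ε F (𝓝 0)) {P : ℕ → ι → Prop} (hP : ∀ N, ∀ᶠ α in F, P N α) :
    ∃ M : ι → ℕ, Tendsto M F atTop ∧ ∀ᶠ α in F, P (M α) α := by
  classical
  -- The search for the largest admissible index is cut off at 1 / ε α, which is finite and tends to
  -- infinity.
  refine ⟨fun α => Nat.findGreatest (fun n => P n α) ⌊1 / ε α⌋₊, ?_, ?_⟩
  · refine tendsto_atTop.2 fun b => ?_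
    have hb : ∀ᶠ α in F, ε α < 1 / ((b : ℝ) + 1) := hε0.eventually_lt_const (by positivity)
    filter_upwards [hP b, hb] with α h1 h2
    refine Nat.le_findGreatest (Nat.le_floor ?_) h1
    rw [le_div_iff₀ (hε α)]
    rw [lt_div_iff₀ (by positivity)] at h2
    nlinarith [hε α]
  -- `P 0 α` covers the default value 0 of `Nat.findGreatest`.
  · filter_upwards [hP 0] with α h
    exact Nat.findGreatest_spec (P := fun n => P n α) (Nat.zero_le _) h

section Strong

variable {𝕜 : Type*} [RCLike 𝕜] {ι : Type*} {E : ι → Type*} [∀ α, NormedAddCommGroup (E α)]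
  [∀ α, InnerProductSpace 𝕜 (E α)] {H : Type*} [NormedAddCommGroup H] [InnerProductSpace 𝕜 H]
  {C : Type*} [AddCommGroup C] [Module 𝕜 C]

/-- `u α ∈ E α` converges strongly to `w ∈ H` along the filter `F`, with respect to the
comparison maps `J α : C → E α` and `J₀ : C → H`. -/
def StrongLim (J : ∀ α, C →ₗ[𝕜] E α) (J₀ : C →ₗ[𝕜] H) (F : Filter ι) (u : ∀ α, E α) (w : H) :
    Prop :=
  ∀ δ > (0 : ℝ), ∃ v, ‖J₀ v - w‖ < δ ∧ ∀ᶠ α in F, ‖J α v - u α‖ < δ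

variable {J : ∀ α, C →ₗ[𝕜] E α} {J₀ : C →ₗ[𝕜] H} {F G : Filter ι}

theorem StrongLim.mono {u : ∀ α, E α} {w : H} (h : StrongLim J J₀ F u w) (hG : G ≤ F) :
    StrongLim J J₀ G u w := fun δ hδ =>
  let ⟨v, h1, h2⟩ := h δ hδ
  ⟨v, h1, hG h2⟩

theorem strongLim_zero_of_norm {u : ∀ α, E α} (h : Tendsto (fun α => ‖u α‖) F (𝓝 0)) :
    StrongLim J J₀ F u 0 := fun δ hδ =>
  ⟨0, by simpa using hδ, by
    filter_upwards [h.eventually_lt_const hδ] with α hα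
    simpa using hα⟩

theorem StrongLim.add {u u' : ∀ α, E α} {w w' : H} (h : StrongLim J J₀ F u w)
    (h' : StrongLim J J₀ F u' w') : StrongLim J J₀ F (fun α => u α + u' α) (w + w') := by
  intro δ hδ
  obtain ⟨v, h1, h2⟩ := h (δ / 2) (by positivity)
  obtain ⟨v', h1', h2'⟩ := h' (δ / 2) (by positivity)
  refine ⟨v + v', ?_, ?_⟩
  · rw [map_add, add_sub_add_comm]
    exact (norm_add_le _ _).trans_lt (by linarith)
  · filter_upwards [h2, h2'] with α h3 h4
    rw [map_add, add_sub_add_comm]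
    exact (norm_add_le _ _).trans_lt (by linarith)

theorem StrongLim.const_smul {u : ∀ α, E α} {w : H} (h : StrongLim J J₀ F u w) (c : 𝕜) :
    StrongLim J J₀ F (fun α => c • u α) (c • w) := by
  intro δ hδ
  obtain ⟨v, h1, h2⟩ := h (δ / (‖c‖ + 1)) (by positivity)
  have key : ∀ x : ℝ, 0 ≤ x → x < δ / (‖c‖ + 1) → ‖c‖ * x < δ := by
    intro x hx hxx
    rw [lt_div_iff₀ (by positivity)] at hxx
    nlinarith [norm_nonneg c]
  refine ⟨c • v, ?_, ?_⟩
  · rw [map_smul, ← smul_sub, norm_smul]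
    exact key _ (norm_nonneg _) h1
  · filter_upwards [h2] with α h3
    rw [map_smul, ← smul_sub, norm_smul]
    exact key _ (norm_nonneg _) h3

theorem StrongLim.sub {u u' : ∀ α, E α} {w w' : H} (h : StrongLim J J₀ F u w)
    (h' : StrongLim J J₀ F u' w') : StrongLim J J₀ F (fun α => u α - u' α) (w - w') := by
  simpa [sub_eq_add_neg] using h.add (h'.const_smul (-1))

theorem StrongLim.sum {κ : Type*} (s : Finset κ) {u : κ → ∀ α, E α} {w : κ → H}
    (h : ∀ i ∈ s, StrongLim J J₀ F (u i) (w i)) :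
    StrongLim J J₀ F (fun α => ∑ i ∈ s, u i α) (∑ i ∈ s, w i) := by
  classical
  induction s using Finset.induction_on with
  | empty => exact strongLim_zero_of_norm (by simpa using tendsto_const_nhds)
  | insert a s ha ih =>
    simp only [Finset.sum_insert ha]
    exact (h a (by simp)).add (ih fun i hi => h i (by simp [hi]))

theorem StrongLim.congr {u u' : ∀ α, E α} {w : H} (h : StrongLim J J₀ F u w)
    (h' : Tendsto (fun α => ‖u' α - u α‖) F (𝓝 0)) : StrongLim J J₀ F u' w := by
  simpa using h.add (strongLim_zero_of_norm h')

theorem StrongLim.congr' {u u' : ∀ α, E α} {w : H} (h : StrongLim J J₀ F u w)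
    (h' : ∀ᶠ α in F, u' α = u α) : StrongLim J J₀ F u' w := by
  refine h.congr (tendsto_const_nhds.congr' ?_)
  filter_upwards [h'] with α hα
  simp [hα]

theorem StrongLim.tendsto_norm (hJ : ∀ v, Tendsto (fun α => ‖J α v‖) F (𝓝 ‖J₀ v‖))
    {u : ∀ α, E α} {w : H} (h : StrongLim J J₀ F u w) :
    Tendsto (fun α => ‖u α‖) F (𝓝 ‖w‖) := by
  rw [Metric.tendsto_nhds]
  intro δ hδ
  obtain ⟨v, h1, h2⟩ := h (δ / 3) (by positivity)
  have h3 := Metric.tendsto_nhds.1 (hJ v) (δ / 3) (by positivity)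
  filter_upwards [h2, h3] with α h4 h5
  rw [Real.dist_eq] at h5 ⊢
  have a1 := (abs_norm_sub_norm_le (J₀ v) w)
  have a2 := (abs_norm_sub_norm_le (J α v) (u α))
  rw [abs_le] at a1 a2
  rw [abs_lt] at h5 ⊢
  constructor <;> linarith [a1.1, a1.2, a2.1, a2.2, h5.1, h5.2]

theorem StrongLim.tendsto_zero (hJ : ∀ v, Tendsto (fun α => ‖J α v‖) F (𝓝 ‖J₀ v‖))
    {u : ∀ α, E α} (h : StrongLim J J₀ F u 0) : Tendsto (fun α => ‖u α‖) F (𝓝 0) := by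
  simpa using h.tendsto_norm hJ

/-- Polarization reduces this to convergence of norms of strongly convergent nets. -/
theorem StrongLim.tendsto_inner (hJ : ∀ v, Tendsto (fun α => ‖J α v‖) F (𝓝 ‖J₀ v‖))
    {u u' : ∀ α, E α} {w w' : H} (h : StrongLim J J₀ F u w) (h' : StrongLim J J₀ F u' w') :
    Tendsto (fun α => inner 𝕜 (u α) (u' α)) F (𝓝 (inner 𝕜 w w')) := by
  simp only [inner_eq_sum_norm_sq_div_four]
  have hc : ∀ {f : ι → ℝ} {a : ℝ}, Tendsto f F (𝓝 a) →
      Tendsto (fun α => ((f α : ℝ) : 𝕜) ^ 2) F (𝓝 ((a : 𝕜) ^ 2)) := fun hf =>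
    (((RCLike.continuous_ofReal (K := 𝕜)).tendsto _).comp hf).pow 2
  have hI := h'.const_smul (RCLike.I : 𝕜)
  exact (((hc ((h.add h').tendsto_norm hJ)).sub (hc ((h.sub h').tendsto_norm hJ))).add
    (((hc ((h.sub hI).tendsto_norm hJ)).sub (hc ((h.add hI).tendsto_norm hJ))).mul_const
      _)).div_const _

theorem StrongLim.smul (hJ : ∀ v, Tendsto (fun α => ‖J α v‖) F (𝓝 ‖J₀ v‖))
    {u : ∀ α, E α} {w : H} (h : StrongLim J J₀ F u w) {c : ι → 𝕜} {c₀ : 𝕜}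
    (hc : Tendsto c F (𝓝 c₀)) : StrongLim J J₀ F (fun α => c α • u α) (c₀ • w) := by
  refine (h.const_smul c₀).congr ?_
  have h1 : Tendsto (fun α => ‖c α - c₀‖) F (𝓝 0) := by
    simpa using (hc.sub_const c₀).norm
  simpa [← sub_smul, norm_smul] using h1.mul (h.tendsto_norm hJ)

/-- Every vector of `H` is a strong limit. -/
theorem exists_strongLim {ε : ι → ℝ} (hε : ∀ α, 0 < ε α) (hε0 : Tendsto ε F (𝓝 0))
    (hJ : ∀ v, Tendsto (fun α => ‖J α v‖) F (𝓝 ‖J₀ v‖)) (hd : DenseRange J₀) (w : H) :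
    ∃ u : ∀ α, E α, StrongLim J J₀ F u w := by
  have hv : ∀ n : ℕ, ∃ v, ‖J₀ v - w‖ < 1 / ((n : ℝ) + 1) := fun n => by
    obtain ⟨v, hv⟩ := hd.exists_dist_lt w (ε := 1 / ((n : ℝ) + 1)) (by positivity)
    exact ⟨v, by rwa [← dist_eq_norm, dist_comm]⟩
  choose v hv using hv
  -- The moving approximant `v (M α)` is compared with all earlier `v n` at once, so that its lift
  -- stays near the lift of each fixed `v n`.
  obtain ⟨M, hM, hP⟩ := exists_diagonal hε hε0
    (P := fun M α => ∀ n ∈ Finset.range (M + 1),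
      ‖J α (v n - v M)‖ < ‖J₀ (v n - v M)‖ + 1 / ((M : ℝ) + 1)) (by
    intro N
    refine (Finset.eventually_all _).2 fun n _ => ?_
    exact (hJ (v n - v N)).eventually_lt_const (by linarith [Nat.one_div_pos_of_nat (α := ℝ) (n := N)]))
  refine ⟨fun α => J α (v (M α)), fun δ hδ => ?_⟩
  obtain ⟨n, hn⟩ := exists_nat_one_div_lt (show 0 < δ / 3 by positivity)
  refine ⟨v n, (hv n).trans (by linarith), ?_⟩
  filter_upwards [hP, hM.eventually_ge_atTop n] with α h1 h2
  have h3 := h1 n (Finset.mem_range.2 (by omega))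
  rw [map_sub, map_sub] at h3
  have h4 : ‖J₀ (v n) - J₀ (v (M α))‖ ≤ ‖J₀ (v n) - w‖ + ‖J₀ (v (M α)) - w‖ := by
    rw [norm_sub_rev (J₀ (v (M α)))]
    exact norm_sub_le_norm_sub_add_norm_sub _ _ _
  have h5 : 1 / ((M α : ℝ) + 1) ≤ 1 / ((n : ℝ) + 1) := Nat.one_div_le_one_div h2
  have := hv n
  have := hv (M α)
  linarith

end Strong

/-! ### Compactness of the limit and asymptotic compactness -/

/-- A separable Hilbert space has a sequence of pairwise orthogonal vectors of norm `0` or `1`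
such that the Fourier expansion of every vector converges to it. -/
theorem exists_orthogonal_sequence (𝕜 : Type*) [RCLike 𝕜] (H : Type*) [NormedAddCommGroup H]
    [InnerProductSpace 𝕜 H] [CompleteSpace H] [SecondCountableTopology H] :
    ∃ e : ℕ → H, (∀ l k, l ≠ k → inner 𝕜 (e l) (e k) = 0) ∧ (∀ l, e l = 0 ∨ ‖e l‖ = 1) ∧
      ∀ w, Tendsto (fun n => ∑ l ∈ Finset.range n, inner 𝕜 (e l) w • e l) atTop (𝓝 w) := by
  classical
  obtain ⟨s, b, hb⟩ := exists_hilbertBasis 𝕜 H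
  have hs : Countable s := by
    -- Basis vectors are at distance √2, so balls of radius 1/2 are disjoint and separability leaves
    -- only countably many.
    have hdisj : (Set.univ : Set s).PairwiseDisjoint fun i => Metric.ball (b i) (1 / 2) := by
      intro i _ j _ hij
      refine Metric.ball_disjoint_ball ?_
      have h1 := b.orthonormal.2 hij
      have h2 : dist (b i) (b j) ^ 2 = 2 := by
        rw [dist_eq_norm, @norm_sub_sq 𝕜, h1, b.orthonormal.1 i, b.orthonormal.1 j]
        norm_num
      nlinarith [dist_nonneg (x := b i) (y := b j)]
    have := hdisj.countable_of_isOpen (fun i _ => Metric.isOpen_ball)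
      (fun i _ => Metric.nonempty_ball.2 (by norm_num))
    exact Set.countable_univ_iff.1 this
  obtain ⟨g, hg⟩ := hs.exists_injective_nat
  -- Padding by zero treats finite and infinite dimension alike; hence norm 0 is allowed.
  refine ⟨Function.extend g b 0, ?_, ?_, ?_⟩
  · intro l k hlk
    by_cases hl : ∃ i, g i = l
    · by_cases hk : ∃ j, g j = k
      · obtain ⟨i, rfl⟩ := hl
        obtain ⟨j, rfl⟩ := hk
        rw [hg.extend_apply, hg.extend_apply]
        exact b.orthonormal.2 fun h => hlk (by rw [h])
      · simp [Function.extend_apply' _ _ _ hk]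
    · simp [Function.extend_apply' _ _ _ hl]
  · intro l
    by_cases hl : ∃ i, g i = l
    · obtain ⟨i, rfl⟩ := hl
      exact Or.inr (by rw [hg.extend_apply]; exact b.orthonormal.1 i)
    · exact Or.inl (by simp [Function.extend_apply' _ _ _ hl])
  · intro w
    refine HasSum.tendsto_sum_nat ((hg.hasSum_iff (f := fun l =>
      inner 𝕜 (Function.extend g b 0 l) w • Function.extend g b 0 l) ?_).1 ?_)
    · intro l hl
      simp [Function.extend_apply' _ _ _ hl]
    · simpa [Function.comp_def, hg.extend_apply, b.repr_apply_apply] using b.hasSum_repr w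

section Compactness

variable {𝕜 : Type*} [RCLike 𝕜] {ι : Type*} {E : ι → Type*} [∀ α, NormedAddCommGroup (E α)]
  [∀ α, InnerProductSpace 𝕜 (E α)] {H : Type*} [NormedAddCommGroup H] [InnerProductSpace 𝕜 H]
  {C : Type*} [AddCommGroup C] [Module 𝕜 C]
  {J : ∀ α, C →ₗ[𝕜] E α} {J₀ : C →ₗ[𝕜] H} {F G : Filter ι}

/-- For bounded nets, weak convergence to `0` may be tested on a sequence with dense span. -/
theorem tendsto_inner_zero_of_forall_seq
    (hJ : ∀ v, Tendsto (fun α => ‖J α v‖) F (𝓝 ‖J₀ v‖)) {e : ℕ → H}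
    (he : ∀ w, Tendsto (fun n => ∑ l ∈ Finset.range n, inner 𝕜 (e l) w • e l) atTop (𝓝 w))
    {s : ℕ → ∀ α, E α} (hs : ∀ l, StrongLim J J₀ F (s l) (e l)) {u : ∀ α, E α} {B : ℝ}
    (hu : ∀ᶠ α in F, ‖u α‖ ≤ B)
    (h : ∀ l, Tendsto (fun α => (inner 𝕜 (u α) (s l α) : 𝕜)) F (𝓝 0))
    {v : ∀ α, E α} {z : H} (hv : StrongLim J J₀ F v z) :
    Tendsto (fun α => (inner 𝕜 (u α) (v α) : 𝕜)) F (𝓝 0) := by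
  rw [Metric.tendsto_nhds]
  intro δ hδ
  have hB : 0 < |B| + 1 := by positivity
  obtain ⟨n, hn⟩ := ((Metric.tendsto_nhds.1 (he z)) (δ / 2 / (|B| + 1)) (by positivity)).exists
  -- `y` lifts a truncated Fourier expansion of `z`: `v - y` is small in norm, and `⟪u, y⟫` is a
  -- fixed finite combination of null nets.
  set y : ∀ α, E α := fun α => ∑ l ∈ Finset.range n, (inner 𝕜 (e l) z : 𝕜) • s l α with hy
  have hyl : StrongLim J J₀ F y (∑ l ∈ Finset.range n, (inner 𝕜 (e l) z : 𝕜) • e l) :=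
    StrongLim.sum _ fun l _ => (hs l).const_smul _
  have h1 := ((hv.sub hyl).tendsto_norm hJ).eventually_lt_const
    (by rwa [dist_comm, dist_eq_norm] at hn)
  have h2 : Tendsto (fun α => (inner 𝕜 (u α) (y α) : 𝕜)) F (𝓝 0) := by
    simp only [hy, inner_sum, inner_smul_right]
    simpa using tendsto_finsetSum (Finset.range n)
      fun l _ => (h l).const_mul (inner 𝕜 (e l) z : 𝕜)
  filter_upwards [h1, hu, Metric.tendsto_nhds.1 h2 (δ / 2) (by positivity)] with α h3 h4 h5
  rw [dist_zero_right] at h5 ⊢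
  have h6 : (inner 𝕜 (u α) (v α) : 𝕜) = inner 𝕜 (u α) (v α - y α) + inner 𝕜 (u α) (y α) := by
    rw [← inner_add_right, sub_add_cancel]
  rw [h6]
  refine (norm_add_le _ _).trans_lt ?_
  have h7 : ‖(inner 𝕜 (u α) (v α - y α) : 𝕜)‖ ≤ δ / 2 := by
    refine (norm_inner_le_norm _ _).trans ?_
    rw [lt_div_iff₀ hB] at h3
    have := le_abs_self B
    nlinarith [norm_nonneg (v α - y α)]
  linarith

/-- Compact convergence of bounded operators in terms of `StrongLim`. -/
def CompactLim (J : ∀ α, C →ₗ[𝕜] E α) (J₀ : C →ₗ[𝕜] H) (F : Filter ι)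
    (R : ∀ α, E α →L[𝕜] E α) (R₀ : H →L[𝕜] H) : Prop :=
  ∀ (u : ∀ α, E α) (w : H), (∀ (v : ∀ α, E α) (z : H), StrongLim J J₀ F v z →
    Tendsto (fun α => (inner 𝕜 (u α) (v α) : 𝕜)) F (𝓝 (inner 𝕜 w z))) →
    StrongLim J J₀ F (fun α => R α (u α)) (R₀ w)

variable {R : ∀ α, E α →L[𝕜] E α} {R₀ : H →L[𝕜] H}

/-- Strong convergence implies weak convergence, by convergence of inner products. -/
theorem CompactLim.strong (hR : CompactLim J J₀ F R R₀)
    (hJ : ∀ v, Tendsto (fun α => ‖J α v‖) F (𝓝 ‖J₀ v‖)) {u : ∀ α, E α} {w : H}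
    (hu : StrongLim J J₀ F u w) : StrongLim J J₀ F (fun α => R α (u α)) (R₀ w) :=
  hR u w fun _ _ hv => hu.tendsto_inner hJ hv

/-- The limit of a compactly convergent net is small on the orthogonal complement of the first
vectors of an orthogonal sequence. -/
theorem CompactLim.small_on_tail [NeBot F] {ε : ι → ℝ} (hε : ∀ α, 0 < ε α)
    (hε0 : Tendsto ε F (𝓝 0)) (hJ : ∀ v, Tendsto (fun α => ‖J α v‖) F (𝓝 ‖J₀ v‖))
    (hd : DenseRange J₀) (hR : CompactLim J J₀ F R R₀) {e : ℕ → H}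
    (he : ∀ w, Tendsto (fun n => ∑ l ∈ Finset.range n, inner 𝕜 (e l) w • e l) atTop (𝓝 w))
    {c : ℝ} (hc : 0 < c) :
    ∃ n, ∀ x : H, ‖x‖ ≤ 1 → (∀ l < n, inner 𝕜 (e l) x = (0 : 𝕜)) → ‖R₀ x‖ ≤ c := by
  by_contra! hcon
  choose x hx1 hx2 hx3 using hcon
  choose s hs using fun l => exists_strongLim hε hε0 hJ hd (e l)
  choose y hy using fun l => exists_strongLim hε hε0 hJ hd (x l)
  -- The hypothesis sees only nets in the `E α`, so the counterexamples `x n` are lifted and a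
  -- diagonal is taken. It is bounded and weakly null, yet its images keep norm above `c`.
  obtain ⟨M, hM, hP⟩ := exists_diagonal hε hε0 (P := fun M α => ‖y M α‖ ≤ 2 ∧
      (∀ l ∈ Finset.range M, ‖(inner 𝕜 (y M α) (s l α) : 𝕜)‖ < 1 / ((M : ℝ) + 1)) ∧
      c < ‖R α (y M α)‖) (by
    intro N
    refine Filter.Eventually.and ?_ (Filter.Eventually.and ?_ ?_)
    · exact ((hy N).tendsto_norm hJ).eventually_le_const (by linarith [hx1 N])
    · refine (Finset.eventually_all _).2 fun l hl => ?_
      refine ((hy N).tendsto_inner hJ (hs l)).norm.eventually_lt_const ?_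
      rw [norm_inner_symm, hx2 N l (Finset.mem_range.1 hl), norm_zero]
      positivity
    · exact ((hR.strong hJ (hy N)).tendsto_norm hJ).eventually_const_lt (hx3 N))
  have hw : ∀ l, Tendsto (fun α => (inner 𝕜 (y (M α) α) (s l α) : 𝕜)) F (𝓝 0) := by
    intro l
    refine squeeze_zero_norm' ?_ (tendsto_one_div_add_atTop_nhds_zero_nat.comp hM)
    filter_upwards [hP, hM.eventually_gt_atTop l] with α h1 h2
    exact (h1.2.1 l (Finset.mem_range.2 h2)).le
  have h0 := (hR (fun α => y (M α) α) 0 fun v z hv => by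
    simpa using tendsto_inner_zero_of_forall_seq hJ he hs (hP.mono fun α h => h.1) hw hv)
  rw [map_zero] at h0
  obtain ⟨α, h1, h2⟩ := (hP.and ((h0.tendsto_zero hJ).eventually_lt_const hc)).exists
  exact lt_asymm h1.2.2 h2

/-- The limit of a compactly convergent net maps bounded weakly null nets to null nets. -/
theorem CompactLim.tendsto_zero_of_weak [NeBot F] {ε : ι → ℝ} (hε : ∀ α, 0 < ε α)
    (hε0 : Tendsto ε F (𝓝 0)) (hJ : ∀ v, Tendsto (fun α => ‖J α v‖) F (𝓝 ‖J₀ v‖))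
    (hd : DenseRange J₀) (hR : CompactLim J J₀ F R R₀) {e : ℕ → H}
    (he0 : ∀ l k, l ≠ k → inner 𝕜 (e l) (e k) = (0 : 𝕜)) (he1 : ∀ l, e l = 0 ∨ ‖e l‖ = 1)
    (he : ∀ w, Tendsto (fun n => ∑ l ∈ Finset.range n, inner 𝕜 (e l) w • e l) atTop (𝓝 w))
    {κ : Type*} {K : Filter κ} {x : κ → H} {B : ℝ} (hx : ∀ᶠ i in K, ‖x i‖ ≤ B)
    (hw : ∀ l, Tendsto (fun i => (inner 𝕜 (e l) (x i) : 𝕜)) K (𝓝 0)) :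
    Tendsto (fun i => ‖R₀ (x i)‖) K (𝓝 0) := by
  rw [Metric.tendsto_nhds]
  intro δ hδ
  have hB : 0 < |B| + 1 := by positivity
  obtain ⟨n, hn⟩ := hR.small_on_tail hε hε0 hJ hd he
    (show 0 < δ / 2 / (|B| + 1) by positivity)
  -- `p` is the component along the first `n` vectors: it tends to 0 in norm, and `x - p` lies where
  -- `R₀` is small.
  set p : κ → H := fun i => ∑ l ∈ Finset.range n, (inner 𝕜 (e l) (x i) : 𝕜) • e l with hp
  have hp0 : Tendsto p K (𝓝 0) := by
    simpa using tendsto_finsetSum (Finset.range n) fun l _ => (hw l).smul_const (e l)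
  have hRp : Tendsto (fun i => ‖R₀ (p i)‖) K (𝓝 0) := by
    simpa using ((R₀.continuous.tendsto _).comp hp0).norm
  filter_upwards [hx, hp0.norm.eventually_lt_const (show ‖(0 : H)‖ < 1 by simp),
    hRp.eventually_lt_const (show 0 < δ / 2 by positivity)] with i h1 h2 h3
  rw [dist_zero_right, norm_norm]
  have h4 : ‖x i - p i‖ ≤ |B| + 1 :=
    (norm_sub_le _ _).trans (by linarith [le_abs_self B])
  have h5 : ∀ l < n, inner 𝕜 (e l) (x i - p i) = (0 : 𝕜) := by
    intro l hl
    rw [inner_sub_right, hp, inner_sum, Finset.sum_eq_single l, inner_smul_right,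
      inner_self_eq_norm_sq_to_K]
    · rcases he1 l with h | h <;> simp [h]
    · intro k _ hk
      rw [inner_smul_right, he0 l k hk.symm, mul_zero]
    · intro h
      exact absurd (Finset.mem_range.2 hl) h
  have h6 := hn (((|B| + 1 : ℝ) : 𝕜)⁻¹ • (x i - p i)) (by
      rw [norm_smul, norm_inv, RCLike.norm_ofReal, abs_of_pos hB, inv_mul_le_iff₀ hB]
      linarith) (fun l hl => by rw [inner_smul_right, h5 l hl, mul_zero])
  rw [map_smul, norm_smul, norm_inv, RCLike.norm_ofReal, abs_of_pos hB, inv_mul_le_iff₀ hB,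
    mul_div_cancel₀ _ hB.ne'] at h6
  calc ‖R₀ (x i)‖ = ‖R₀ (x i - p i) + R₀ (p i)‖ := by rw [← map_add, sub_add_cancel]
    _ ≤ ‖R₀ (x i - p i)‖ + ‖R₀ (p i)‖ := norm_add_le _ _
    _ < δ := by linarith

theorem norm_sq_sum_smul_eq {V : Type*} [NormedAddCommGroup V] [InnerProductSpace 𝕜 V] (M : ℕ)
    (a : ℕ → V) (c : ℕ → 𝕜) :
    ((‖∑ l ∈ Finset.range M, c l • a l‖ ^ 2 : ℝ) : 𝕜) = ∑ l ∈ Finset.range M,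
      ∑ k ∈ Finset.range M, starRingEnd 𝕜 (c l) * c k * inner 𝕜 (a l) (a k) := by
  rw [RCLike.ofReal_pow, ← inner_self_eq_norm_sq_to_K, sum_inner]
  refine Finset.sum_congr rfl fun l _ => ?_
  rw [inner_sum]
  refine Finset.sum_congr rfl fun k _ => ?_
  rw [inner_smul_left, inner_smul_right]
  ring

/-- Linear combinations of two families with close Gram matrices have close norms. -/
theorem norm_sq_sum_smul_le {V W : Type*} [NormedAddCommGroup V] [InnerProductSpace 𝕜 V]
    [NormedAddCommGroup W] [InnerProductSpace 𝕜 W] {M : ℕ} {a : ℕ → V} {b : ℕ → W} {η : ℝ}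
    (h : ∀ l ∈ Finset.range M, ∀ k ∈ Finset.range M,
      ‖(inner 𝕜 (a l) (a k) - inner 𝕜 (b l) (b k) : 𝕜)‖ ≤ η) (c : ℕ → 𝕜) :
    ‖∑ l ∈ Finset.range M, c l • a l‖ ^ 2 ≤
      ‖∑ l ∈ Finset.range M, c l • b l‖ ^ 2 + η * M * ∑ l ∈ Finset.range M, ‖c l‖ ^ 2 := by
  have h1 : ‖((‖∑ l ∈ Finset.range M, c l • a l‖ ^ 2 -
      ‖∑ l ∈ Finset.range M, c l • b l‖ ^ 2 : ℝ) : 𝕜)‖ ≤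
      η * (∑ l ∈ Finset.range M, ‖c l‖) ^ 2 := by
    rw [RCLike.ofReal_sub, norm_sq_sum_smul_eq, norm_sq_sum_smul_eq, ← Finset.sum_sub_distrib, sq, Finset.sum_mul_sum,
      Finset.mul_sum]
    refine norm_sum_le_of_le _ fun l hl => ?_
    rw [← Finset.sum_sub_distrib, Finset.mul_sum]
    refine norm_sum_le_of_le _ fun k hk => ?_
    rw [← mul_sub, norm_mul, norm_mul, RCLike.norm_conj, mul_comm]
    exact mul_le_mul_of_nonneg_right (h l hl k hk) (by positivity)
  rw [RCLike.norm_ofReal] at h1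
  rcases Nat.eq_zero_or_pos M with rfl | hM
  · simp
  have hη : 0 ≤ η := (norm_nonneg _).trans
    (h 0 (Finset.mem_range.2 hM) 0 (Finset.mem_range.2 hM))
  -- Cauchy–Schwarz is the source of the factor `M` in the error.
  have h2 : (∑ l ∈ Finset.range M, ‖c l‖) ^ 2 ≤ M * ∑ l ∈ Finset.range M, ‖c l‖ ^ 2 := by
    simpa using sq_sum_le_card_mul_sum_sq (s := Finset.range M) (f := fun l => ‖c l‖)
  have h3 := mul_le_mul_of_nonneg_left h2 hη
  linarith [le_abs_self (‖∑ l ∈ Finset.range M, c l • a l‖ ^ 2 -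
      ‖∑ l ∈ Finset.range M, c l • b l‖ ^ 2)]

/-- Bounded nets converging weakly to `0` along a finer filter are mapped to null nets. -/
theorem CompactLim.tendsto_zero [NeBot F] {ε : ι → ℝ} (hε : ∀ α, 0 < ε α)
    (hε0 : Tendsto ε F (𝓝 0)) (hJ : ∀ v, Tendsto (fun α => ‖J α v‖) F (𝓝 ‖J₀ v‖))
    (hd : DenseRange J₀) (hR : CompactLim J J₀ F R R₀) [CompleteSpace H]
    [SecondCountableTopology H] (hG : G ≤ F) {u : ∀ α, E α} (hu : ∀ α, ‖u α‖ ≤ 1)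
    (h : ∀ (v : ∀ α, E α) (z : H), StrongLim J J₀ G v z →
      Tendsto (fun α => (inner 𝕜 (v α) (u α) : 𝕜)) G (𝓝 0)) :
    Tendsto (fun α => ‖R α (u α)‖) G (𝓝 0) := by
  obtain ⟨e, he0, he1, he⟩ := exists_orthogonal_sequence 𝕜 H
  choose s hs using fun l => exists_strongLim hε hε0 hJ hd (e l)
  -- The tolerance 1/(M+1)² absorbs the factor `M` lost in `norm_sq_sum_smul_le`. Gram matrices are
  -- controlled both for the lifts and for their images under `R`.
  obtain ⟨M, hM, hP⟩ := exists_diagonal hε hε0 (P := fun M α =>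
    (∀ l ∈ Finset.range M, ∀ k ∈ Finset.range M,
      ‖(inner 𝕜 (s l α) (s k α) - inner 𝕜 (e l) (e k) : 𝕜)‖ ≤ 1 / ((M : ℝ) + 1) ^ 2) ∧
    (∀ l ∈ Finset.range M, ∀ k ∈ Finset.range M,
      ‖(inner 𝕜 (R α (s l α)) (R α (s k α)) - inner 𝕜 (R₀ (e l)) (R₀ (e k)) : 𝕜)‖ ≤
        1 / ((M : ℝ) + 1) ^ 2)) (by
    intro N
    have hlim : ∀ {a : ι → 𝕜} {z : 𝕜}, Tendsto a F (𝓝 z) →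
        ∀ᶠ α in F, ‖a α - z‖ ≤ 1 / ((N : ℝ) + 1) ^ 2 := by
      intro a z ha
      filter_upwards [Metric.tendsto_nhds.1 ha (1 / ((N : ℝ) + 1) ^ 2) (by positivity)] with α hα
      exact (dist_eq_norm (a α) z ▸ hα).le
    refine Filter.Eventually.and ?_ ?_ <;>
    refine (Finset.eventually_all _).2 fun l _ => (Finset.eventually_all _).2 fun k _ => ?_
    · exact hlim ((hs l).tendsto_inner hJ (hs k))
    · exact hlim ((hR.strong hJ (hs l)).tendsto_inner hJ (hR.strong hJ (hs k))))
  -- `y` is an approximate orthogonal projection of `u` onto the first `M α` lifts, and `x` is its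
  -- mirror image in `H`.
  set c : ℕ → ι → 𝕜 := fun l α => inner 𝕜 (s l α) (u α) with hc
  set y : ∀ α, E α := fun α => ∑ l ∈ Finset.range (M α), c l α • s l α with hy
  set x : ι → H := fun α => ∑ l ∈ Finset.range (M α), c l α • e l with hx
  set q : ι → ℝ := fun α => ∑ l ∈ Finset.range (M α), ‖c l α‖ ^ 2 with hq
  have hq0 : ∀ α, 0 ≤ q α := fun α => Finset.sum_nonneg fun _ _ => by positivity
  have he2 : ∀ l, ‖e l‖ ≤ 1 := fun l => by rcases he1 l with h | h <;> simp [h]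
  have hηM : ∀ n : ℕ, 1 / ((n : ℝ) + 1) ^ 2 * n ≤ 1 / ((n : ℝ) + 1) := by
    intro n
    rw [one_div_mul_eq_div, div_le_div_iff₀ (by positivity) (by positivity)]
    nlinarith [(Nat.cast_nonneg n : (0 : ℝ) ≤ n)]
  have hη1 : ∀ n : ℕ, 1 / ((n : ℝ) + 1) ≤ 1 := fun n => by
    rw [div_le_one (by positivity)]
    linarith [(Nat.cast_nonneg n : (0 : ℝ) ≤ n)]
  have hxq : ∀ α, ‖x α‖ ^ 2 ≤ q α := by
    intro α
    have h1 : ((‖x α‖ ^ 2 : ℝ) : 𝕜) =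
        ((∑ l ∈ Finset.range (M α), ‖c l α‖ ^ 2 * ‖e l‖ ^ 2 : ℝ) : 𝕜) := by
      rw [RCLike.ofReal_pow, ← inner_self_eq_norm_sq_to_K, hx, sum_inner, RCLike.ofReal_sum]
      refine Finset.sum_congr rfl fun l hl => ?_
      rw [inner_sum, Finset.sum_eq_single l]
      · rw [inner_smul_left, inner_smul_right, inner_self_eq_norm_sq_to_K, ← mul_assoc,
          RCLike.conj_mul]
        push_cast
        ring
      · intro k _ hk
        rw [inner_smul_left, inner_smul_right, he0 l k hk.symm, mul_zero, mul_zero]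
      · intro h
        exact absurd hl h
    rw [RCLike.ofReal_inj.1 h1]
    refine Finset.sum_le_sum fun l _ => ?_
    have := he2 l
    exact mul_le_of_le_one_right (by positivity) (by nlinarith [norm_nonneg (e l)])
  have hyq : ∀ᶠ α in F, ‖y α‖ ^ 2 ≤ 2 * q α := by
    filter_upwards [hP] with α hα
    have h1 := norm_sq_sum_smul_le hα.1 (fun l => c l α)
    have h2 := mul_le_mul_of_nonneg_right ((hηM (M α)).trans (hη1 (M α))) (hq0 α)
    linarith [hxq α]
  -- An approximate Bessel inequality: q = ⟪y, u⟫ ≤ ‖y‖ and ‖y‖² ≤ 2q give q² ≤ 2q.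
  have hq2 : ∀ᶠ α in F, q α ≤ 2 := by
    filter_upwards [hyq] with α hα
    have h1 : ((q α : ℝ) : 𝕜) = inner 𝕜 (y α) (u α) := by
      rw [hy, sum_inner, hq, RCLike.ofReal_sum]
      refine Finset.sum_congr rfl fun l _ => ?_
      rw [inner_smul_left, RCLike.ofReal_pow, ← RCLike.conj_mul]
    have h2 : q α ≤ ‖y α‖ := by
      have h3 := congrArg norm h1
      rw [RCLike.norm_ofReal, abs_of_nonneg (hq0 α)] at h3
      rw [h3]
      refine (norm_inner_le_norm _ _).trans ?_
      exact mul_le_of_le_one_right (norm_nonneg _) (hu α)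
    nlinarith [hq0 α, norm_nonneg (y α)]
  -- the remainder is weakly null along `F`
  have hrem : Tendsto (fun α => ‖R α (u α - y α)‖) F (𝓝 0) := by
    have hb : ∀ᶠ α in F, ‖u α - y α‖ ≤ 3 := by
      filter_upwards [hyq, hq2] with α h1 h2
      have : ‖y α‖ ≤ 2 := by nlinarith [norm_nonneg (y α)]
      exact (norm_sub_le _ _).trans (by linarith [hu α])
    have hw : ∀ l, Tendsto (fun α => (inner 𝕜 (u α - y α) (s l α) : 𝕜)) F (𝓝 0) := by
      intro l
      rcases he1 l with hl0 | hl1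
      · have hz : Tendsto (fun α => 3 * ‖s l α‖) F (𝓝 0) := by
          simpa [hl0] using ((hs l).tendsto_norm hJ).const_mul 3
        refine squeeze_zero_norm' ?_ hz
        filter_upwards [hb] with α h1
        exact (norm_inner_le_norm _ _).trans (mul_le_mul_of_nonneg_right h1 (norm_nonneg _))
      have hz : Tendsto (fun α => 2 * (1 / ((M α : ℝ) + 1))) F (𝓝 0) := by
        simpa [Function.comp_def] using
          ((tendsto_one_div_add_atTop_nhds_zero_nat (𝕜 := ℝ)).comp hM).const_mul 2
      refine squeeze_zero_norm' ?_ hz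
      filter_upwards [hP, hq2, hM.eventually_gt_atTop l] with α h1 h2 h3
      have hl : l ∈ Finset.range (M α) := Finset.mem_range.2 h3
      have hce : ∀ k ∈ Finset.range (M α), ‖c k α‖ ≤ 2 := by
        intro k hk
        have h4 : ‖c k α‖ ^ 2 ≤ q α :=
          Finset.single_le_sum (f := fun k => ‖c k α‖ ^ 2) (fun _ _ => by positivity) hk
        nlinarith [norm_nonneg (c k α)]
      have hcl : c l α = ∑ k ∈ Finset.range (M α),
          c k α * inner 𝕜 (e l) (e k) := by
        rw [Finset.sum_eq_single l]
        · rw [inner_self_eq_norm_sq_to_K, hl1]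
          simp
        · intro k _ hk
          rw [he0 l k hk.symm, mul_zero]
        · intro h
          exact absurd hl h
      -- With an exactly orthonormal family this would vanish; only the Gram errors remain.
      have hdiff : (inner 𝕜 (s l α) (u α - y α) : 𝕜) = -∑ k ∈ Finset.range (M α),
          c k α * (inner 𝕜 (s l α) (s k α) - inner 𝕜 (e l) (e k)) := by
        simp only [mul_sub, Finset.sum_sub_distrib]
        rw [← hcl, inner_sub_right, hy, inner_sum]
        simp only [inner_smul_right]
        ring
      rw [norm_inner_symm, hdiff, norm_neg]
      calc ‖∑ k ∈ Finset.range (M α), c k α * (inner 𝕜 (s l α) (s k α) - inner 𝕜 (e l) (e k))‖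
          ≤ ∑ k ∈ Finset.range (M α), 2 * (1 / ((M α : ℝ) + 1) ^ 2) := by
            refine norm_sum_le_of_le _ fun k hk => ?_
            rw [norm_mul]
            exact mul_le_mul (hce k hk) (h1.1 l hl k hk) (norm_nonneg _) (by norm_num)
        _ = 2 * (1 / ((M α : ℝ) + 1) ^ 2 * M α) := by
            rw [Finset.sum_const, Finset.card_range, nsmul_eq_mul]
            ring
        _ ≤ 2 * (1 / ((M α : ℝ) + 1)) := by linarith [hηM (M α)]
    have h0 := hR (fun α => u α - y α) 0 fun v z hv => by
      simpa using tendsto_inner_zero_of_forall_seq hJ he hs hb hw hv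
    rw [map_zero] at h0
    exact h0.tendsto_zero hJ
  -- Weak nullity along `G` enters only here: it makes each coordinate `c l` of `x` a null net.
  have hRx : Tendsto (fun α => ‖R₀ (x α)‖) G (𝓝 0) := by
    refine hR.tendsto_zero_of_weak hε hε0 hJ hd he0 he1 he (B := 2) ?_ fun l => ?_
    · filter_upwards [hG hq2] with α h1
      nlinarith [hxq α, norm_nonneg (x α)]
    · refine squeeze_zero_norm' ?_ (by simpa using (h (s l) (e l) ((hs l).mono hG)).norm)
      filter_upwards [hG (hM.eventually_gt_atTop l)] with α h1
      rw [hx, inner_sum, Finset.sum_eq_single l]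
      · rw [inner_smul_right, norm_mul]
        refine mul_le_of_le_one_right (norm_nonneg _) ((norm_inner_le_norm _ _).trans ?_)
        exact mul_le_one₀ (he2 l) (norm_nonneg _) (he2 l)
      · intro k _ hk
        rw [inner_smul_right, he0 l k hk.symm, mul_zero]
      · intro h2
        exact absurd (Finset.mem_range.2 h1) h2
  have hbound : Tendsto (fun α => ‖R α (u α - y α)‖ +
      √(‖R₀ (x α)‖ ^ 2 + 2 * (1 / ((M α : ℝ) + 1)))) G (𝓝 0) := by
    have h1 := ((tendsto_one_div_add_atTop_nhds_zero_nat (𝕜 := ℝ)).comp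
      (hM.mono_left hG)).const_mul 2
    simpa [Function.comp_def] using
      (hrem.mono_left hG).add (((hRx.pow 2).add h1).sqrt)
  refine squeeze_zero' (Eventually.of_forall fun _ => norm_nonneg _) ?_ hbound
  filter_upwards [hG hP, hG hq2] with α h1 h2
  have h3 := norm_sq_sum_smul_le h1.2 (fun l => c l α)
  have h4 := mul_le_mul_of_nonneg_right (hηM (M α)) (hq0 α)
  have h5 : ‖R α (y α)‖ ≤ √(‖R₀ (x α)‖ ^ 2 + 2 * (1 / ((M α : ℝ) + 1))) := by
    refine Real.le_sqrt_of_sq_le ?_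
    have h6 : R α (y α) = ∑ l ∈ Finset.range (M α), c l α • R α (s l α) := by simp [hy]
    have h7 : R₀ (x α) = ∑ l ∈ Finset.range (M α), c l α • R₀ (e l) := by simp [hx]
    rw [h6, h7]
    have h8 : 0 ≤ 1 / ((M α : ℝ) + 1) := by positivity
    nlinarith
  calc ‖R α (u α)‖ = ‖R α (u α - y α) + R α (y α)‖ := by rw [← map_add, sub_add_cancel]
    _ ≤ ‖R α (u α - y α)‖ + ‖R α (y α)‖ := norm_add_le _ _
    _ ≤ _ := by linarith

end Compactness

/-! ### The resolvent at `-1` of a non-negative self-adjoint operator -/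

section Resolvent

variable {𝕜 : Type*} [RCLike 𝕜] {H : Type*} [NormedAddCommGroup H] [InnerProductSpace 𝕜 H]

theorem mem_eigenspace_iff_graph {A : H →ₗ.[𝕜] H} {t : ℝ} {x : H} :
    x ∈ eigenspace A t ↔ ((x, (t : 𝕜) • x) : H × H) ∈ A.graph := Iff.rfl

theorem mem_eigenspace_iff {A : H →ₗ.[𝕜] H} {t : ℝ} {x : H} :
    x ∈ eigenspace A t ↔ ∃ h : x ∈ A.domain, A ⟨x, h⟩ = (t : 𝕜) • x := by
  rw [mem_eigenspace_iff_graph, LinearPMap.mem_graph_iff]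
  constructor
  · rintro ⟨⟨y, hy⟩, rfl, h⟩
    exact ⟨hy, h⟩
  · rintro ⟨h, h'⟩
    exact ⟨⟨x, h⟩, rfl, h'⟩

variable [CompleteSpace H]

namespace SpectralStructure

variable (S : SpectralStructure 𝕜 H)

theorem symmetric (x y : S.A.domain) : inner 𝕜 (S.A x) (y : H) = inner 𝕜 (x : H) (S.A y) := by
  have h := LinearPMap.adjoint_isFormalAdjoint (T := S.A) S.selfAdjoint.dense_domain
  rw [LinearPMap.isSelfAdjoint_def.1 S.selfAdjoint] at h
  exact h x y

/-- Positivity gives ‖x‖² ≤ Re⟪x + Ax, x⟫, and Cauchy–Schwarz concludes. This lower bound makes 1 +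
A injective with closed range. -/
theorem norm_le_norm_add (x : S.A.domain) : ‖(x : H)‖ ≤ ‖(x : H) + S.A x‖ := by
  have h1 : ‖(x : H)‖ ^ 2 ≤ RCLike.re (inner 𝕜 ((x : H) + S.A x) (x : H)) := by
    rw [inner_add_left, map_add, ← norm_sq_eq_re_inner]
    linarith [S.nonneg x]
  have h2 := (RCLike.re_le_norm _).trans (norm_inner_le_norm (𝕜 := 𝕜) ((x : H) + S.A x) (x : H))
  by_contra! h
  nlinarith [norm_nonneg (x : H), norm_nonneg ((x : H) + S.A x)]

/-- On the closed graph of A, the map (x, Ax) ↦ x + Ax is bounded below, hence injective with closed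
range. A vector y orthogonal to the range lies in D(A*) = D(A) with Ay = -y, so it vanishes by the
same lower bound. -/
theorem neg_one_mem_resolventSet : (-1 : 𝕜) ∈ resolventSet S.A := by
  set V := S.A.graph
  have hV : IsClosed (V : Set (H × H)) := S.selfAdjoint.isClosed
  have : CompleteSpace V := hV.completeSpace_coe
  let g : V →L[𝕜] H := (ContinuousLinearMap.fst 𝕜 H H + ContinuousLinearMap.snd 𝕜 H H).comp
    V.subtypeL
  have hg : ∀ p : V, g p = p.1.1 + p.1.2 := fun p => rfl
  have hgA : ∀ x : S.A.domain, ∃ p : V, g p = (x : H) + S.A x ∧ p.1.1 = x := fun x =>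
    ⟨⟨(x, S.A x), S.A.mem_graph x⟩, rfl, rfl⟩
  have hVA : ∀ p : V, ∃ h : p.1.1 ∈ S.A.domain, S.A ⟨p.1.1, h⟩ = p.1.2 := by
    rintro ⟨⟨x, y⟩, hp⟩
    obtain ⟨⟨x', hx'⟩, rfl, h⟩ := (LinearPMap.mem_graph_iff _).1 hp
    exact ⟨hx', h⟩
  have hbound : ∀ p : V, ‖p‖ ≤ (2 : NNReal) * ‖g p‖ := by
    intro p
    obtain ⟨h, h2⟩ := hVA p
    have h3 := S.norm_le_norm_add ⟨p.1.1, h⟩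
    rw [h2] at h3
    have h4 : ‖p.1.2‖ ≤ ‖p.1.1 + p.1.2‖ + ‖p.1.1‖ := by
      simpa using norm_sub_le (p.1.1 + p.1.2) p.1.1
    rw [hg]
    change ‖p.1‖ ≤ 2 * _
    refine norm_prod_le_iff.2 ⟨?_, ?_⟩ <;> linarith [norm_nonneg (p.1.1 + p.1.2)]
  have hanti : AntilipschitzWith 2 g := g.antilipschitz_of_bound hbound
  have hker : g.ker = ⊥ := LinearMap.ker_eq_bot.2 hanti.injective
  have hclosed : IsClosed (g.range : Set H) := by
    exact hanti.isClosed_range g.uniformContinuous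
  have hrange : g.range = ⊤ := by
    have : CompleteSpace g.range := hclosed.completeSpace_coe
    rw [← Submodule.orthogonal_eq_bot_iff, Submodule.eq_bot_iff]
    intro y hy
    have h1 : ∀ x : S.A.domain, inner 𝕜 (-y) (x : H) = inner 𝕜 y (S.A x) := by
      intro x
      obtain ⟨p, hp, -⟩ := hgA x
      have h2 := (Submodule.mem_orthogonal' _ _).1 hy (g p) ⟨p, rfl⟩
      rw [hp, inner_add_right] at h2
      rw [inner_neg_left]
      linear_combination -h2
    have h2 : y ∈ S.A.adjoint.domain := LinearPMap.mem_adjoint_domain_of_exists _ ⟨-y, h1⟩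
    have h3 : S.A.adjoint ⟨y, h2⟩ = -y :=
      LinearPMap.adjoint_apply_eq S.selfAdjoint.dense_domain _ h1
    have h4 : ((y, -y) : H × H) ∈ S.A.graph := by
      rw [← LinearPMap.isSelfAdjoint_def.1 S.selfAdjoint]
      exact (LinearPMap.mem_graph_iff _).2 ⟨⟨y, h2⟩, rfl, h3⟩
    obtain ⟨y', h5, h6⟩ := (LinearPMap.mem_graph_iff _).1 h4
    have h7 := S.norm_le_norm_add y'
    rw [h6, h5] at h7
    simpa using h7
  let Q := ContinuousLinearEquiv.ofBijective g hker hrange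
  have hQ : ∀ p, Q p = g p := fun p => rfl
  -- The sign comes from -1 - A = -(1 + A).
  refine ⟨-((ContinuousLinearMap.fst 𝕜 H H).comp (V.subtypeL.comp Q.symm.toContinuousLinearMap)),
    ?_, ?_⟩
  · intro u
    obtain ⟨h, h1⟩ := hVA (Q.symm u)
    have h2 : (Q.symm u).1.1 + (Q.symm u).1.2 = u := by
      rw [← hg, ← hQ, Q.apply_symm_apply]
    have h3 : -(Q.symm u).1.1 ∈ S.A.domain := S.A.domain.neg_mem h
    have h4 : S.A ⟨-(Q.symm u).1.1, h3⟩ = -(Q.symm u).1.2 := by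
      rw [← h1, ← LinearPMap.map_neg]
      rfl
    refine ⟨h3, ?_⟩
    change (-1 : 𝕜) • (-(Q.symm u).1.1) - S.A ⟨-(Q.symm u).1.1, h3⟩ = u
    rw [h4]
    simpa using h2
  · intro x
    obtain ⟨p, hp, hp1⟩ := hgA x
    have h1 : (-1 : 𝕜) • (x : H) - S.A x = -Q p := by
      rw [hQ, hp, neg_smul, one_smul]
      abel
    rw [h1, map_neg]
    change - -((Q.symm (Q p)).1.1) = _
    rw [Q.symm_apply_apply, hp1, neg_neg]

/-- The operator `(1 + A)⁻¹`, up to sign the resolvent at `-1`. -/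
noncomputable def res : H →L[𝕜] H := resolvent S.A (-1)

theorem isResolventAt_res : IsResolventAt S.A (-1) S.res := by
  have h : ∃ R : H →L[𝕜] H, IsResolventAt S.A (-1) R := S.neg_one_mem_resolventSet
  rw [res, resolvent, dif_pos h]
  exact h.choose_spec

theorem res_mem (u : H) : ∃ h : S.res u ∈ S.A.domain, S.A ⟨S.res u, h⟩ = -u - S.res u := by
  obtain ⟨h, h1⟩ := S.isResolventAt_res.1 u
  refine ⟨h, ?_⟩
  rw [neg_smul, one_smul] at h1
  rw [eq_sub_iff_add_eq, eq_neg_iff_add_eq_zero, add_assoc, ← eq_neg_iff_add_eq_zero]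
  rw [sub_eq_iff_eq_add] at h1
  rw [neg_add, h1]
  abel

theorem norm_res_le (u : H) : ‖S.res u‖ ≤ ‖u‖ := by
  obtain ⟨h, h1⟩ := S.res_mem u
  have h2 := S.norm_le_norm_add ⟨_, h⟩
  rw [h1] at h2
  simpa using h2

theorem res_eq_zero {u : H} (hu : S.res u = 0) : u = 0 := by
  obtain ⟨h, h1⟩ := S.res_mem u
  have h2 : (⟨S.res u, h⟩ : S.A.domain) = 0 := Subtype.ext hu
  rw [h2, hu] at h1
  simpa using h1.symm

theorem res_symmetric (u v : H) : inner 𝕜 (S.res u) v = inner 𝕜 u (S.res v) := by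
  obtain ⟨hu, h1⟩ := S.res_mem u
  obtain ⟨hv, h2⟩ := S.res_mem v
  have h := S.symmetric ⟨_, hu⟩ ⟨_, hv⟩
  rw [h1, h2] at h
  simp only [inner_sub_left, inner_sub_right, inner_neg_left, inner_neg_right] at h
  linear_combination h

theorem nonneg_of_mem_eigenspace {t : ℝ} {x : H} (hx : x ∈ eigenspace S.A t) (h0 : x ≠ 0) :
    0 ≤ t := by
  obtain ⟨h, h1⟩ := mem_eigenspace_iff.1 hx
  have h2 := S.nonneg ⟨x, h⟩
  rw [h1, inner_smul_left, RCLike.conj_ofReal, RCLike.re_ofReal_mul, ← norm_sq_eq_re_inner] at h2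
  exact nonneg_of_mul_nonneg_left h2 (by positivity)

/-- Together with `mem_eigenspace_of_res`, this is the dictionary t ↔ -1/(1+t) between eigenvalues
of A and of its resolvent at -1. -/
theorem res_of_mem_eigenspace {t : ℝ} {x : H} (hx : x ∈ eigenspace S.A t) :
    S.res x = -((((1 + t)⁻¹ : ℝ) : 𝕜) • x) := by
  rcases eq_or_ne x 0 with rfl | h0
  · simp
  have ht := S.nonneg_of_mem_eigenspace hx h0
  obtain ⟨h, h1⟩ := mem_eigenspace_iff.1 hx
  have h2 := S.isResolventAt_res.2 ⟨x, h⟩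
  have h3 : (-1 : 𝕜) • x - S.A ⟨x, h⟩ = (-((1 + t : ℝ) : 𝕜)) • x := by
    rw [h1, ← sub_smul]
    congr 1
    push_cast
    ring
  simp only at h2
  rw [h3, map_smul] at h2
  have h4 : (((1 + t : ℝ)) : 𝕜) ≠ 0 := RCLike.ofReal_ne_zero.2 (by positivity)
  rw [RCLike.ofReal_inv, eq_comm, ← smul_neg, inv_smul_eq_iff₀ h4]
  conv_lhs => rw [← h2]
  rw [neg_smul, neg_neg]

/-- Since μ ≠ 0, x is a multiple of `S.res x` and so lies in the domain; the graph point over `S.res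
x` is rescaled by -μ⁻¹. -/
theorem mem_eigenspace_of_res {μ : ℝ} (hμ : μ ≠ 0) {x : H} (hx : S.res x = -((μ : 𝕜) • x)) :
    x ∈ eigenspace S.A (μ⁻¹ - 1) := by
  obtain ⟨h, h1⟩ := S.res_mem x
  have hμ' : (μ : 𝕜) ≠ 0 := RCLike.ofReal_ne_zero.2 hμ
  have hg : ((S.res x, -x - S.res x) : H × H) ∈ S.A.graph :=
    (LinearPMap.mem_graph_iff _).2 ⟨⟨_, h⟩, rfl, h1⟩
  have hg2 := S.A.graph.smul_mem (-(μ : 𝕜)⁻¹) hg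
  have h2 : -(μ : 𝕜)⁻¹ • S.res x = x := by
    rw [hx, smul_neg, neg_smul, neg_neg, inv_smul_smul₀ hμ']
  have h3 : -(μ : 𝕜)⁻¹ • (-x - S.res x) = ((μ⁻¹ - 1 : ℝ) : 𝕜) • x := by
    rw [smul_sub, h2, smul_neg, neg_smul, neg_neg, RCLike.ofReal_sub, sub_smul,
      RCLike.ofReal_inv, RCLike.ofReal_one, one_smul]
  rwa [Prod.smul_mk, h2, h3] at hg2

theorem inner_eq_zero_of_mem_eigenspace {r t : ℝ} (hrt : r ≠ t) {x y : H}
    (hx : x ∈ eigenspace S.A r) (hy : y ∈ eigenspace S.A t) : inner 𝕜 x y = (0 : 𝕜) := by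
  obtain ⟨h, h1⟩ := mem_eigenspace_iff.1 hx
  obtain ⟨h', h1'⟩ := mem_eigenspace_iff.1 hy
  have h2 := S.symmetric ⟨x, h⟩ ⟨y, h'⟩
  rw [h1, h1', inner_smul_left, inner_smul_right, RCLike.conj_ofReal, ← sub_eq_zero,
    ← sub_mul, ← RCLike.ofReal_sub, mul_eq_zero, RCLike.ofReal_eq_zero, sub_eq_zero] at h2
  exact h2.resolve_left hrt

end SpectralStructure

end Resolvent

/-! ### Eigenbases and the sequence of eigenvalues -/

section Eigenbasis

variable {𝕜 : Type*} [RCLike 𝕜] {H : Type*} [NormedAddCommGroup H] [InnerProductSpace 𝕜 H]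

/-- A vector orthogonal to all but the first `k - 1` vectors of a complete orthonormal family is
in the span of these. -/
theorem mem_span_of_inner_eq_zero {K : Set ℕ} (hK1 : ∀ k ∈ K, 1 ≤ k) {φ : ℕ → H}
    (ho : Orthonormal 𝕜 (fun k : K => φ k))
    (hs : (Submodule.span 𝕜 (φ '' K)).topologicalClosure = ⊤) {k : ℕ} {x : H}
    (hx : ∀ j ∈ K, k ≤ j → inner 𝕜 (φ j) x = (0 : 𝕜)) :
    x ∈ Submodule.span 𝕜 (φ '' (Finset.Ico 1 k : Set ℕ)) := by
  classical
  set y : H := ∑ j ∈ (Finset.Ico 1 k).filter (· ∈ K), (inner 𝕜 (φ j) x : 𝕜) • φ j with hy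
  have horth : ∀ j ∈ K, ∀ i ∈ K, inner 𝕜 (φ j) (φ i) = if j = i then (1 : 𝕜) else 0 := by
    intro j hj i hi
    simpa [Subtype.ext_iff] using (orthonormal_iff_ite.1 ho) ⟨j, hj⟩ ⟨i, hi⟩
  have hz : ∀ j ∈ K, inner 𝕜 (φ j) (x - y) = (0 : 𝕜) := by
    intro j hj
    rw [inner_sub_right, hy, inner_sum]
    by_cases hjk : j < k
    · rw [Finset.sum_eq_single j]
      · rw [inner_smul_right, horth j hj j hj, if_pos rfl, mul_one, sub_self]
      · intro i hi hij
        rw [inner_smul_right, horth j hj i (Finset.mem_filter.1 hi).2, if_neg hij.symm, mul_zero]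
      · intro h
        exact absurd (Finset.mem_filter.2 ⟨Finset.mem_Ico.2 ⟨hK1 j hj, hjk⟩, hj⟩) h
    · rw [hx j hj (not_lt.1 hjk), Finset.sum_eq_zero, sub_zero]
      intro i hi
      have hi' := Finset.mem_filter.1 hi
      have : j ≠ i := by
        have := (Finset.mem_Ico.1 hi'.1).2
        omega
      rw [inner_smul_right, horth j hj i hi'.2, if_neg this, mul_zero]
  have h0 : x - y = 0 := by
    have h1 : x - y ∈ (Submodule.span 𝕜 (φ '' K)).topologicalClosureᗮ := by
      rw [Submodule.orthogonal_closure, Submodule.mem_orthogonal]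
      intro v hv
      induction hv using Submodule.span_induction with
      | mem v hv =>
        obtain ⟨j, hj, rfl⟩ := hv
        exact hz j hj
      | zero => simp
      | add v w _ _ h1 h2 => rw [inner_add_left, h1, h2, add_zero]
      | smul c v _ h1 => rw [inner_smul_left, h1, mul_zero]
    rwa [hs, Submodule.top_orthogonal_eq_bot, Submodule.mem_bot] at h1
  rw [sub_eq_zero.1 h0]
  refine Submodule.sum_mem _ fun j hj => Submodule.smul_mem _ _ (Submodule.subset_span ?_)
  exact ⟨j, (Finset.mem_filter.1 hj).1, rfl⟩

theorem rank_lt_of_le_span {φ : ℕ → H} {k : ℕ} (hk : 1 ≤ k) {W : Submodule 𝕜 H}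
    (hW : W ≤ Submodule.span 𝕜 (φ '' (Finset.Ico 1 k : Set ℕ))) :
    Module.rank 𝕜 W < (k : Cardinal) := by
  classical
  refine ((Submodule.rank_mono hW).trans (rank_span_le _)).trans_lt ?_
  rw [← Finset.coe_image, Finset.coe_sort_coe, Cardinal.mk_coe_finset, Nat.cast_lt]
  refine Finset.card_image_le.trans_lt ?_
  rw [Nat.card_Ico]
  omega

theorem le_rank_of_forall_mem {K : Set ℕ} {φ : ℕ → H}
    (ho : Orthonormal 𝕜 (fun k : K => φ k)) {k : ℕ} (hk : ∀ j, 1 ≤ j → j ≤ k → j ∈ K)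
    {W : Submodule 𝕜 H} (hW : ∀ j, 1 ≤ j → j ≤ k → φ j ∈ W) :
    (k : Cardinal) ≤ Module.rank 𝕜 W := by
  have h1 : LinearIndependent 𝕜 (fun j : Fin k => φ (j + 1)) :=
    ho.linearIndependent.comp (fun j : Fin k => (⟨j + 1, hk _ (by omega) (by omega)⟩ : K))
      fun i j h => by simpa [Fin.ext_iff] using h
  have h2 : LinearIndependent 𝕜
      (fun j : Fin k => (⟨φ (j + 1), hW _ (by omega) (by omega)⟩ : W)) :=
    LinearIndependent.of_comp W.subtype h1
  simpa using h2.cardinal_lift_le_rank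

/-- Only finitely many vectors of an orthonormal family of eigenvectors of a compact operator have
eigenvalues of modulus at least `c > 0`. -/
theorem finite_of_isCompactOperator {R : H →L[𝕜] H} (hR : IsCompactOperator R) {I : Type*}
    {b : I → H} (hb : Orthonormal 𝕜 b) {μ : I → 𝕜} (hμ : ∀ i, R (b i) = μ i • b i) {c : ℝ}
    (hc : 0 < c) : {i | c ≤ ‖μ i‖}.Finite := by
  -- Pigeonhole: two images in one ball of radius c/2 are closer than c, whereas orthogonality puts
  -- them at distance at least √2 c.
  obtain ⟨s, -, hs, hcov⟩ := finite_cover_balls_of_compact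
    (hR.isCompact_closure_image_closedBall 1) (half_pos hc)
  by_contra hinf
  have hf : ∀ i, ∃ y ∈ s, dist (R (b i)) y < c / 2 := by
    intro i
    have h1 : R (b i) ∈ closure (R '' Metric.closedBall 0 1) :=
      subset_closure ⟨b i, by simp [hb.1 i], rfl⟩
    simpa using hcov h1
  choose f hfs hfd using hf
  obtain ⟨i, hi, j, hj, hij, hfij⟩ :=
    Set.Infinite.exists_ne_map_eq_of_mapsTo hinf (fun i _ => hfs i) hs
  have h1 : dist (R (b i)) (R (b j)) < c := by
    have h2 := hfd j
    rw [← hfij] at h2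
    linarith [dist_triangle_right (R (b i)) (R (b j)) (f i), hfd i]
  have h2 : dist (R (b i)) (R (b j)) ^ 2 = ‖μ i‖ ^ 2 + ‖μ j‖ ^ 2 := by
    rw [dist_eq_norm, hμ, hμ, @norm_sub_sq 𝕜, inner_smul_left, inner_smul_right, hb.2 hij,
      norm_smul, norm_smul, hb.1, hb.1]
    simp
  have h3 : c ≤ ‖μ i‖ := hi
  nlinarith [dist_nonneg (x := R (b i)) (y := R (b j)), norm_nonneg (μ j)]

variable [CompleteSpace H]

/-- A complete orthonormal system of eigenvectors, indexed by an initial segment of the positive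
integers with monotone eigenvalues, computes the dimension and all the eigenvalues. -/
theorem SpectralStructure.eigenbasis_of_monotone (S : SpectralStructure 𝕜 H) {K : Set ℕ}
    (hK1 : ∀ k ∈ K, 1 ≤ k) (hK : ∀ k ∈ K, ∀ j, 1 ≤ j → j ≤ k → j ∈ K) {φ : ℕ → H}
    (ho : Orthonormal 𝕜 (fun k : K => φ k))
    (hs : (Submodule.span 𝕜 (φ '' K)).topologicalClosure = ⊤) {t : ℕ → ℝ}
    (ht : ∀ j ∈ K, ∀ k ∈ K, j ≤ k → t j ≤ t k) (hφ : ∀ k ∈ K, φ k ∈ eigenspace S.A (t k)) :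
    dimIndices 𝕜 H = K ∧ IsOrthonormalEigenbasis S.A φ ∧
      (∀ k ∈ K, kthEigenvalue S.A k = (t k : EReal)) ∧
      ∀ k, 1 ≤ k → k ∉ K → kthEigenvalue S.A k = ⊤ := by
  have hle : ∀ k ∈ K, (k : Cardinal) ≤ Module.rank 𝕜 H := by
    intro k hk
    rw [← rank_top 𝕜 H]
    exact le_rank_of_forall_mem ho (hK k hk) fun _ _ _ => Submodule.mem_top
  have hlt : ∀ k, 1 ≤ k → k ∉ K → Module.rank 𝕜 H < (k : Cardinal) := by
    intro k hk1 hk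
    rw [← rank_top 𝕜 H]
    refine rank_lt_of_le_span (φ := φ) hk1 fun x _ => ?_
    refine mem_span_of_inner_eq_zero hK1 ho hs fun j hj hkj => ?_
    exact absurd (hK j hj k hk1 hkj) hk
  have hdim : dimIndices 𝕜 H = K := by
    ext k
    refine ⟨fun hk => ?_, fun hk => ⟨hK1 k hk, hle k hk⟩⟩
    by_contra h
    exact absurd hk.2 (not_le.2 (hlt k hk.1 h))
  have hev : ∀ k ∈ K, kthEigenvalue S.A k = (t k : EReal) := by
    intro k hk
    refine le_antisymm (sInf_le ⟨t k, rfl, ?_⟩) (le_sInf ?_)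
    · refine le_rank_of_forall_mem ho (hK k hk) fun j h1 h2 => ?_
      have hj := hK k hk j h1 h2
      exact Submodule.mem_iSup_of_mem (t j)
        (Submodule.mem_iSup_of_mem (ht j hj k hk h2) (hφ j hj))
    · rintro _ ⟨r, rfl, hr⟩
      rw [EReal.coe_le_coe_iff]
      -- If r < t k, eigenvectors for values ≤ r are orthogonal to every φ j with j ≥ k, so they
      -- span at most k - 1 dimensions.
      by_contra! hrt
      refine absurd hr (not_le.2 (rank_lt_of_le_span (φ := φ) (hK1 k hk) ?_))
      refine iSup₂_le fun r' hr' x hx => ?_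
      refine mem_span_of_inner_eq_zero hK1 ho hs fun j hj hkj => ?_
      have := ht k hk j hj hkj
      exact S.inner_eq_zero_of_mem_eigenspace (by linarith : r' < t j).ne' (hφ j hj) hx
  refine ⟨hdim, ⟨?_, ?_, ?_⟩, hev, ?_⟩
  · rw [hdim]
    exact ho
  · rw [hdim]
    exact hs
  · intro k hk
    rw [hdim] at hk
    exact ⟨t k, hev k hk, hφ k hk⟩
  · intro k hk1 hk
    rw [kthEigenvalue, sInf_eq_top]
    rintro _ ⟨r, rfl, hr⟩
    exact absurd (hr.trans (Submodule.rank_le _)) (not_le.2 (hlt k hk1 hk))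

/-- If the sublevel sets of a function are finite, its domain can be enumerated increasingly. -/
theorem exists_monotone_enumeration {I : Type*} (T : I → ℝ) (hT : ∀ B, {i | T i ≤ B}.Finite) :
    ∃ r : I → ℕ, Function.Injective r ∧ (∀ i, 1 ≤ r i) ∧
      (∀ i j, 1 ≤ j → j ≤ r i → j ∈ Set.range r) ∧ ∀ i j, r i ≤ r j → T i ≤ T j := by
  classical
  -- Ties of `T` are broken by a well-order; the rank of `i` is then one plus its number of
  -- predecessors, finite by `hT`.
  let lt : I → I → Prop := fun i j => T i < T j ∨ (T i = T j ∧ WellOrderingRel i j)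
  have htrans : ∀ {i j k}, lt i j → lt j k → lt i k := by
    rintro i j k (h | ⟨h, h'⟩) (g | ⟨g, g'⟩)
    · exact Or.inl (h.trans g)
    · exact Or.inl (g ▸ h)
    · exact Or.inl (h ▸ g)
    · exact Or.inr ⟨h.trans g, _root_.trans h' g'⟩
  have hirr : ∀ i, ¬ lt i i := by
    rintro i (h | ⟨-, h⟩)
    · exact lt_irrefl _ h
    · exact irrefl _ h
  have htri : ∀ i j, lt i j ∨ i = j ∨ lt j i := by
    intro i j
    rcases lt_trichotomy (T i) (T j) with h | h | h
    · exact Or.inl (Or.inl h)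
    · rcases trichotomous_of WellOrderingRel i j with g | g | g
      · exact Or.inl (Or.inr ⟨h, g⟩)
      · exact Or.inr (Or.inl g)
      · exact Or.inr (Or.inr (Or.inr ⟨h.symm, g⟩))
    · exact Or.inr (Or.inr (Or.inl h))
  have hfin : ∀ i, {j | lt j i}.Finite := fun i => (hT (T i)).subset (by
    rintro j (h | h)
    · exact h.le
    · exact h.1.le)
  let r : I → ℕ := fun i => {j | lt j i}.ncard + 1
  have hmono : ∀ {i j}, lt i j → r i < r j := by
    intro i j hij
    refine Nat.succ_lt_succ (Set.ncard_lt_ncard ⟨fun k hk => htrans hk hij, fun h => ?_⟩ (hfin j))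
    exact hirr i (h hij)
  refine ⟨r, ?_, fun i => Nat.le_add_left _ _, ?_, ?_⟩
  · intro i j hij
    rcases htri i j with h | h | h
    · exact absurd hij (hmono h).ne
    · exact h
    · exact absurd hij (hmono h).ne'
  -- No rank is skipped: the predecessor of largest rank is the immediate one.
  · have hpred : ∀ i, 2 ≤ r i → ∃ j, r j + 1 = r i := by
      intro i hi
      have hne : {j | lt j i}.Nonempty := by
        rw [← Set.ncard_pos (hfin i)]
        change 2 ≤ _ + 1 at hi
        omega
      obtain ⟨j, hj, hmax⟩ := Set.exists_max_image _ r (hfin i) hne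
      refine ⟨j, ?_⟩
      have h1 : {k | lt k i} = insert j {k | lt k j} := by
        ext k
        refine ⟨fun hk => ?_, ?_⟩
        · rcases htri k j with h | h | h
          · exact Or.inr h
          · exact Or.inl h
          · exact absurd (hmax k hk) (not_le.2 (hmono h))
        · rintro (rfl | h)
          · exact hj
          · exact htrans h hj
      change _ = {k | lt k i}.ncard + 1
      have h2 : j ∉ {k | lt k j} := hirr j
      rw [h1, Set.ncard_insert_of_notMem h2 (hfin j)]
    intro i j hj hji
    obtain ⟨d, hd⟩ := Nat.exists_eq_add_of_le hji
    induction d generalizing i with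
    | zero => exact ⟨i, hd⟩
    | succ d ih =>
      obtain ⟨k, hk⟩ := hpred i (by omega)
      exact ih k (by omega) (by omega)
  · intro i j hij
    by_contra! h
    exact absurd (hmono (Or.inl h : lt j i)) (not_lt.2 hij)

/-- A non-negative self-adjoint operator with compact resolvent has an eigenbasis. -/
theorem SpectralStructure.exists_eigenbasis (S : SpectralStructure 𝕜 H)
    (hR : IsCompactOperator S.res) : ∃ φ : ℕ → H, IsOrthonormalEigenbasis S.A φ := by
  have hsym : S.res.IsSymmetric := fun u v => S.res_symmetric u v
  let V : 𝕜 → Submodule 𝕜 H := fun μ => Module.End.eigenspace (S.res : Module.End 𝕜 H) μ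
  have hVmem : ∀ μ x, x ∈ V μ ↔ S.res x = μ • x := fun μ x => Module.End.mem_eigenspace_iff
  have hVc : ∀ μ, CompleteSpace (V μ) := by
    intro μ
    refine IsClosed.completeSpace_coe (hs := ?_)
    have : (V μ : Set H) = {x | S.res x = μ • x} := by
      ext x
      exact hVmem μ x
    rw [this]
    exact isClosed_eq S.res.continuous (continuous_const_smul μ)
  choose s b hb using fun μ => exists_hilbertBasis 𝕜 (V μ)
  let c : (Σ μ, s μ) → H := fun i => b i.1 i.2
  have hc : Orthonormal 𝕜 c :=
    hsym.orthogonalFamily_eigenspaces.orthonormal_sigma_orthonormal fun μ => (b μ).orthonormal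
  have hce : ∀ i, S.res (c i) = i.1 • c i := fun i => (hVmem _ _).1 (b i.1 i.2).2
  have hc0 : ∀ i, c i ≠ 0 := fun i => hc.ne_zero i
  have hreal : ∀ i : Σ μ, s μ, ((RCLike.re i.1 : ℝ) : 𝕜) = i.1 := by
    intro i
    refine RCLike.conj_eq_iff_re.1 (hsym.conj_eigenvalue_eq_self ?_)
    exact Module.End.hasEigenvalue_of_hasEigenvector ⟨(hVmem _ _).2 (hce i), hc0 i⟩
  have hne : ∀ i : Σ μ, s μ, RCLike.re i.1 ≠ 0 := by
    intro i h
    refine hc0 i (S.res_eq_zero ?_)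
    rw [hce, ← hreal, h, RCLike.ofReal_zero, zero_smul]
  -- The solution T of μ = -1/(1+T).
  let T : (Σ μ, s μ) → ℝ := fun i => (-RCLike.re i.1)⁻¹ - 1
  have hT : ∀ i, c i ∈ eigenspace S.A (T i) := by
    intro i
    refine S.mem_eigenspace_of_res (neg_ne_zero.2 (hne i)) ?_
    rw [hce, RCLike.ofReal_neg, hreal, neg_smul, neg_neg]
  have hT0 : ∀ i, 0 ≤ T i := fun i => S.nonneg_of_mem_eigenspace (hT i) (hc0 i)
  have hTfin : ∀ B, {i | T i ≤ B}.Finite := by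
    intro B
    refine (finite_of_isCompactOperator hR hc (μ := fun i => i.1) hce
      (c := (1 + |B|)⁻¹) (by positivity)).subset fun i hi => ?_
    have h1 : T i ≤ B := hi
    have h2 := S.res_of_mem_eigenspace (hT i)
    have h3 := congrArg norm h2
    rw [hce, norm_neg, norm_smul, norm_smul, hc.1, mul_one, mul_one, RCLike.norm_ofReal,
      abs_of_nonneg (inv_nonneg.2 (by linarith [hT0 i]))] at h3
    change (1 + |B|)⁻¹ ≤ ‖i.1‖
    rw [h3]
    exact inv_anti₀ (by linarith [hT0 i]) (by linarith [le_abs_self B])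
  obtain ⟨r, hr, hr1, hrseg, hrmono⟩ := exists_monotone_enumeration T hTfin
  have hφ : ∀ i, Function.extend r c 0 (r i) = c i := fun i => hr.extend_apply _ _ i
  have ht : ∀ i, Function.extend r T 0 (r i) = T i := fun i => hr.extend_apply _ _ i
  have himg : Function.extend r c 0 '' Set.range r = Set.range c := by
    rw [← Set.range_comp]
    congr 1
    ext i
    exact hφ i
  refine ⟨Function.extend r c 0, (S.eigenbasis_of_monotone (K := Set.range r)
    (t := Function.extend r T 0) ?_ ?_ ?_ ?_ ?_ ?_).2.1⟩
  · rintro _ ⟨i, rfl⟩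
    exact hr1 i
  · rintro _ ⟨i, rfl⟩ j hj hji
    exact hrseg i j hj hji
  · constructor
    · rintro ⟨_, i, rfl⟩
      simpa [hφ] using hc.1 i
    · rintro ⟨_, i, rfl⟩ ⟨_, j, rfl⟩ hij
      simpa [hφ] using hc.2 fun h => hij (by rw [h])
  · rw [himg, Submodule.topologicalClosure_eq_top_iff, Submodule.eq_bot_iff]
    intro x hx
    -- Orthogonality to each Hilbert basis passes to the whole eigenspace; the spectral theorem for
    -- the compact symmetric operator `S.res` then forces x = 0.
    have h1 : x ∈ (⨆ μ, V μ)ᗮ := by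
      rw [← Submodule.iInf_orthogonal, Submodule.mem_iInf]
      intro μ
      rw [Submodule.mem_orthogonal']
      intro v hv
      have h2 := ((b μ).hasSum_repr ⟨v, hv⟩).mapL ((innerSL 𝕜 x).comp (V μ).subtypeL)
      have h3 : ∀ i, ((innerSL 𝕜 x).comp (V μ).subtypeL)
          ((b μ).repr ⟨v, hv⟩ i • b μ i) = 0 := by
        intro i
        have h4 := (Submodule.mem_orthogonal' _ _).1 hx (c ⟨μ, i⟩)
          (Submodule.subset_span ⟨_, rfl⟩)
        rw [map_smul]
        change _ • inner 𝕜 x (c ⟨μ, i⟩) = 0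
        rw [h4, smul_zero]
      simp only [h3] at h2
      exact h2.unique hasSum_zero
    rwa [ContinuousLinearMap.orthogonalComplement_iSup_eigenspaces_eq_bot hR hsym,
      Submodule.mem_bot] at h1
  · rintro _ ⟨i, rfl⟩ _ ⟨j, rfl⟩ hij
    rw [ht, ht]
    exact hrmono i j hij
  · rintro _ ⟨i, rfl⟩
    rw [hφ, ht]
    exact hT i

end Eigenbasis

/-! ### Bounds for eigenvalues and for the resolvent -/

section EigenvalueBounds

variable {𝕜 : Type*} [RCLike 𝕜] {H : Type*} [NormedAddCommGroup H] [InnerProductSpace 𝕜 H]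

theorem kthEigenvalue_mono (A : H →ₗ.[𝕜] H) : Monotone (kthEigenvalue A) := by
  intro j k hjk
  refine sInf_le_sInf ?_
  rintro _ ⟨t, rfl, ht⟩
  exact ⟨t, rfl, (Nat.cast_le.2 hjk).trans ht⟩

theorem mem_dimIndices_of_kthEigenvalue_lt_top {A : H →ₗ.[𝕜] H} {k : ℕ} (hk : 1 ≤ k)
    (h : kthEigenvalue A k < ⊤) : k ∈ dimIndices 𝕜 H := by
  obtain ⟨_, ⟨t, rfl, ht⟩, -⟩ := sInf_lt_iff.1 h
  exact ⟨hk, ht.trans (Submodule.rank_le _)⟩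

variable [CompleteSpace H]

namespace SpectralStructure

variable (S : SpectralStructure 𝕜 H)

theorem kthEigenvalue_nonneg {k : ℕ} (hk : 1 ≤ k) : 0 ≤ kthEigenvalue S.A k := by
  refine le_sInf ?_
  rintro _ ⟨t, rfl, ht⟩
  by_contra! h
  have ht0 : t < 0 := by exact_mod_cast h
  have hbot : (⨆ r : ℝ, ⨆ _ : r ≤ t, eigenspace S.A r) = ⊥ := by
    refine iSup₂_eq_bot.2 fun r hr => (Submodule.eq_bot_iff _).2 fun x hx => ?_
    by_contra hx0
    linarith [S.nonneg_of_mem_eigenspace hx hx0]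
  rw [hbot, rank_bot] at ht
  have : k ≤ 0 := by exact_mod_cast ht
  omega

/-- On the orthogonal complement of the first eigenvectors the resolvent is bounded in terms of
the next eigenvalue. -/
theorem norm_res_le_of_orthogonal {φ : ℕ → H} (hφ : IsOrthonormalEigenbasis S.A φ) {k : ℕ}
    {B : ℝ} (hB : 0 ≤ B) (hk : (B : EReal) ≤ kthEigenvalue S.A k) {u : H}
    (hu : ∀ j ∈ dimIndices 𝕜 H, j < k → inner 𝕜 (φ j) u = (0 : 𝕜)) :
    ‖S.res u‖ ≤ (1 + B)⁻¹ * ‖u‖ := by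
  obtain ⟨ho, hs, he⟩ := hφ
  let b : HilbertBasis (dimIndices 𝕜 H) 𝕜 H := HilbertBasis.mk ho (by
    rw [← hs, Set.image_eq_range])
  have hb : ∀ i, b i = φ i := fun i => by simp [b]
  have hnorm : ∀ x : H, HasSum (fun i => ‖(inner 𝕜 (b i) x : 𝕜)‖ ^ 2) (‖x‖ ^ 2) := by
    intro x
    have h := (b.hasSum_inner_mul_inner x x).mapL (RCLike.reCLM (K := 𝕜))
    rw [RCLike.reCLM_apply, inner_self_eq_norm_sq] at h
    have h2 : ∀ i, ‖(inner 𝕜 (b i) x : 𝕜)‖ ^ 2 = RCLike.re (inner 𝕜 x (b i) * inner 𝕜 (b i) x) :=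
      fun i => by rw [inner_mul_symm_re_eq_norm, norm_mul, norm_inner_symm x, sq]
    simp only [h2]
    exact h
  -- By Parseval it suffices to compare coefficients: those of index below k vanish, the others are
  -- multiplied by -1/(1+t) with t ≥ B.
  have hle : ∀ i, ‖(inner 𝕜 (b i) (S.res u) : 𝕜)‖ ^ 2 ≤
      ((1 + B)⁻¹) ^ 2 * ‖(inner 𝕜 (b i) u : 𝕜)‖ ^ 2 := by
    intro i
    obtain ⟨t, ht, hmem⟩ := he i i.2
    rw [hb, ← S.res_symmetric, S.res_of_mem_eigenspace hmem, inner_neg_left, norm_neg,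
      inner_smul_left, norm_mul, RCLike.norm_conj, RCLike.norm_ofReal, mul_pow, sq_abs]
    rcases lt_or_ge (i : ℕ) k with h | h
    · rw [hu i i.2 h]
      simp
    · have h1 : (B : EReal) ≤ t := ht ▸ hk.trans (kthEigenvalue_mono S.A h)
      have h2 : B ≤ t := by exact_mod_cast h1
      refine mul_le_mul_of_nonneg_right ?_ (by positivity)
      refine pow_le_pow_left₀ (inv_nonneg.2 (by linarith)) ?_ 2
      exact inv_anti₀ (by linarith) (by linarith)
  have h1 := hasSum_le hle (hnorm (S.res u)) ((hnorm u).mul_left _)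
  rw [← mul_pow] at h1
  exact le_of_sq_le_sq h1 (by positivity)

end SpectralStructure

end EigenvalueBounds

/-! ### Passage to the limit along an ultrafilter -/

section Ultra

variable {𝕜 : Type*} [RCLike 𝕜] {ι : Type*} {E : ι → Type*} [∀ α, NormedAddCommGroup (E α)]
  [∀ α, InnerProductSpace 𝕜 (E α)] {H : Type*} [NormedAddCommGroup H] [InnerProductSpace 𝕜 H]
  {C : Type*} [AddCommGroup C] [Module 𝕜 C]
  {J : ∀ α, C →ₗ[𝕜] E α} {J₀ : C →ₗ[𝕜] H} {F : Filter ι} {U : Ultrafilter ι}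

/-- Bounded nets have weak limits along ultrafilters. -/
theorem exists_weak_limit [CompleteSpace H]
    (hJ : ∀ v, Tendsto (fun α => ‖J α v‖) U (𝓝 ‖J₀ v‖))
    (hs : ∀ w, ∃ u : ∀ α, E α, StrongLim J J₀ U u w) {u : ∀ α, E α} (hu : ∀ α, ‖u α‖ ≤ 1) :
    ∃ w : H, ∀ (v : ∀ α, E α) (z : H), StrongLim J J₀ U v z →
      Tendsto (fun α => (inner 𝕜 (u α) (v α) : 𝕜)) U (𝓝 (inner 𝕜 w z)) := by
  choose s hs using hs
  have hbd : ∀ (v : ∀ α, E α) α, ‖(inner 𝕜 (u α) (v α) : 𝕜)‖ ≤ ‖v α‖ := fun v α =>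
    (norm_inner_le_norm _ _).trans (mul_le_of_le_one_left (norm_nonneg _) (hu α))
  have hex : ∀ z, ∃ a : 𝕜, Tendsto (fun α => (inner 𝕜 (u α) (s z α) : 𝕜)) U (𝓝 a) := by
    intro z
    have h1 : ∀ᶠ α in U, (inner 𝕜 (u α) (s z α) : 𝕜) ∈ Metric.closedBall (0 : 𝕜) (‖z‖ + 1) := by
      filter_upwards [((hs z).tendsto_norm hJ).eventually_lt_const
        (show ‖z‖ < ‖z‖ + 1 by linarith)] with α hα
      rw [mem_closedBall_zero_iff]
      exact (hbd _ α).trans hα.le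
    obtain ⟨a, -, ha⟩ := (isCompact_closedBall (0 : 𝕜) (‖z‖ + 1)).ultrafilter_le_nhds
      (U.map fun α => (inner 𝕜 (u α) (s z α) : 𝕜)) (by
        rw [Ultrafilter.coe_map, le_principal_iff]
        exact h1)
    exact ⟨a, ha⟩
  choose a ha using hex
  -- The limit depends on `z` only, not on its lift; so `a` is linear of norm at most 1, and the
  -- Riesz theorem represents it.
  have key : ∀ (v : ∀ α, E α) (z : H), StrongLim J J₀ U v z →
      Tendsto (fun α => (inner 𝕜 (u α) (v α) : 𝕜)) U (𝓝 (a z)) := by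
    intro v z hv
    have h1 : Tendsto (fun α => (inner 𝕜 (u α) (v α - s z α) : 𝕜)) U (𝓝 0) := by
      refine squeeze_zero_norm (fun α => hbd (fun α => v α - s z α) α) ?_
      simpa using (hv.sub (hs z)).tendsto_norm hJ
    simpa [inner_sub_right] using h1.add (ha z)
  let ℓ : H →ₗ[𝕜] 𝕜 :=
    { toFun := a
      map_add' := fun x y => by
        refine tendsto_nhds_unique (key _ _ ((hs x).add (hs y))) ?_
        simpa [inner_add_right] using (ha x).add (ha y)
      map_smul' := fun c x => by
        refine tendsto_nhds_unique (key _ _ ((hs x).const_smul c)) ?_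
        simpa [inner_smul_right] using (ha x).const_mul c }
  have hℓ : ∀ x, ‖ℓ x‖ ≤ 1 * ‖x‖ := fun x => by
    rw [one_mul]
    exact le_of_tendsto_of_tendsto' (ha x).norm ((hs x).tendsto_norm hJ) fun α => hbd _ α
  refine ⟨(InnerProductSpace.toDual 𝕜 H).symm (ℓ.mkContinuous 1 hℓ), fun v z hv => ?_⟩
  rw [InnerProductSpace.toDual_symm_apply]
  exact key v z hv

theorem StrongLim.unique [NeBot F] (hJ : ∀ v, Tendsto (fun α => ‖J α v‖) F (𝓝 ‖J₀ v‖))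
    {u : ∀ α, E α} {w w' : H} (h : StrongLim J J₀ F u w) (h' : StrongLim J J₀ F u w') :
    w = w' := by
  have h1 := (h.sub h').tendsto_norm hJ
  simp only [sub_self, norm_zero] at h1
  exact sub_eq_zero.1 (norm_eq_zero.1 (tendsto_nhds_unique h1 tendsto_const_nhds))

variable {R : ∀ α, E α →L[𝕜] E α} {R₀ : H →L[𝕜] H}

/-- Compactly convergent nets of contractions preserve strong convergence along finer filters. -/
theorem CompactLim.strong_of_le {G : Filter ι} {ε : ι → ℝ} (hε : ∀ α, 0 < ε α)
    (hε0 : Tendsto ε F (𝓝 0)) (hJ : ∀ v, Tendsto (fun α => ‖J α v‖) F (𝓝 ‖J₀ v‖))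
    (hd : DenseRange J₀) (hR : CompactLim J J₀ F R R₀) (hR1 : ∀ α x, ‖R α x‖ ≤ ‖x‖)
    (hG : G ≤ F) {u : ∀ α, E α} {w : H} (hu : StrongLim J J₀ G u w) :
    StrongLim J J₀ G (fun α => R α (u α)) (R₀ w) := by
  -- The hypothesis needs a net converging along all of `F`, so `u` is replaced by such a lift of
  -- `w`; the contractions absorb the difference.
  obtain ⟨s, hs⟩ := exists_strongLim hε hε0 hJ hd w
  refine ((hR.strong hJ hs).mono hG).congr ?_
  have h1 : Tendsto (fun α => ‖u α - s α‖) G (𝓝 0) := by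
    simpa using (hu.sub (hs.mono hG)).tendsto_norm fun v => (hJ v).mono_left hG
  refine squeeze_zero (fun _ => norm_nonneg _) (fun α => ?_) h1
  rw [← map_sub]
  exact hR1 α _

/-- Asymptotic compactness: images of bounded nets have strong limits along ultrafilters. -/
theorem CompactLim.exists_strong_limit [CompleteSpace H] [SecondCountableTopology H] [NeBot F]
    {ε : ι → ℝ} (hε : ∀ α, 0 < ε α)
    (hε0 : Tendsto ε F (𝓝 0)) (hJ : ∀ v, Tendsto (fun α => ‖J α v‖) F (𝓝 ‖J₀ v‖))
    (hd : DenseRange J₀) (hR : CompactLim J J₀ F R R₀)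
    (hU : (U : Filter ι) ≤ F) {u : ∀ α, E α} (hu : ∀ α, ‖u α‖ ≤ 1) :
    ∃ y : H, StrongLim J J₀ U (fun α => R α (u α)) y := by
  classical
  have hJU := fun v => (hJ v).mono_left hU
  have hex : ∀ w, ∃ u : ∀ α, E α, StrongLim J J₀ F u w := exists_strongLim hε hε0 hJ hd
  obtain ⟨w, hw⟩ := exists_weak_limit (u := u) hJU
    (fun w => (hex w).imp fun _ h => h.mono hU) hu
  obtain ⟨s, hs⟩ := hex w
  refine ⟨R₀ w, ((hR.strong hJ hs).mono hU).congr ?_⟩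
  have hB : 0 < ‖w‖ + 2 := by positivity
  have hev : ∀ᶠ α in U, ‖s α‖ ≤ ‖w‖ + 1 :=
    ((hs.mono hU).tendsto_norm hJU).eventually_le_const (by linarith)
  -- `CompactLim.tendsto_zero` asks for norm at most 1 at every index, so the weakly null net `u -
  -- s` is rescaled, and set to 0 where `s` is too large.
  set x : ∀ α, E α := fun α =>
    if ‖s α‖ ≤ ‖w‖ + 1 then ((‖w‖ + 2 : ℝ) : 𝕜)⁻¹ • (u α - s α) else 0 with hx
  have hxe : ∀ᶠ α in U, x α = ((‖w‖ + 2 : ℝ) : 𝕜)⁻¹ • (u α - s α) :=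
    hev.mono fun α hα => by simp only [hx, if_pos hα]
  have hx1 : ∀ α, ‖x α‖ ≤ 1 := by
    intro α
    simp only [hx]
    split_ifs with h
    · rw [norm_smul, norm_inv, RCLike.norm_ofReal, abs_of_pos hB, inv_mul_le_iff₀ hB]
      exact (norm_sub_le _ _).trans (by linarith [hu α])
    · simp
  have h0 := hR.tendsto_zero hε hε0 hJ hd hU hx1 fun v z hv => by
    rw [tendsto_zero_iff_norm_tendsto_zero]
    simp only [norm_inner_symm (v _)]
    rw [← tendsto_zero_iff_norm_tendsto_zero]
    have h1 := ((hw v z hv).sub ((hs.mono hU).tendsto_inner hJU hv)).const_mul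
      (((‖w‖ + 2 : ℝ) : 𝕜)⁻¹)
    rw [sub_self, mul_zero] at h1
    refine h1.congr' ?_
    filter_upwards [hxe] with α hα
    rw [hα, inner_smul_left, inner_sub_left, map_inv₀, RCLike.conj_ofReal]
  have h2 := h0.const_mul (‖w‖ + 2)
  rw [mul_zero] at h2
  refine h2.congr' ?_
  filter_upwards [hxe] with α hα
  rw [hα, map_smul, norm_smul, norm_inv, RCLike.norm_ofReal, abs_of_pos hB,
    mul_inv_cancel_left₀ hB.ne', map_sub]

end Ultra

/-! ### Limits of eigenvalues and eigenvectors -/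

section Limit

variable {𝕜 : Type*} [RCLike 𝕜] {ι : Type*} {E : ι → Type*} [∀ α, NormedAddCommGroup (E α)]
  [∀ α, InnerProductSpace 𝕜 (E α)] {H : Type*} [NormedAddCommGroup H] [InnerProductSpace 𝕜 H]
  {C : Type*} [AddCommGroup C] [Module 𝕜 C]
  {J : ∀ α, C →ₗ[𝕜] E α} {J₀ : C →ₗ[𝕜] H} {F : Filter ι} {U : Ultrafilter ι}
  [∀ α, CompleteSpace (E α)] [CompleteSpace H]

/-- Eigenvectors whose eigenvalues stay bounded have strong limits, which are eigenvectors. -/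
theorem exists_limit_eigenvector [SecondCountableTopology H] [NeBot F]
    {ε : ι → ℝ} (hε : ∀ α, 0 < ε α)
    (hε0 : Tendsto ε F (𝓝 0)) (hJ : ∀ v, Tendsto (fun α => ‖J α v‖) F (𝓝 ‖J₀ v‖))
    (hd : DenseRange J₀) {S : ∀ α, SpectralStructure 𝕜 (E α)} {S₀ : SpectralStructure 𝕜 H}
    (hR : CompactLim J J₀ F (fun α => (S α).res) S₀.res) (hU : (U : Filter ι) ≤ F)
    {u : ∀ α, E α} {t : ι → ℝ} {t₀ : ℝ} (ht : Tendsto t U (𝓝 t₀)) (ht0 : 0 ≤ t₀)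
    (hu : ∀ᶠ α in U, ‖u α‖ = 1 ∧ u α ∈ eigenspace (S α).A (t α)) :
    ∃ w : H, StrongLim J J₀ U u w ∧ w ∈ eigenspace S₀.A t₀ := by
  classical
  have hJU := fun v => (hJ v).mono_left hU
  obtain ⟨y, hy⟩ := hR.exists_strong_limit hε hε0 hJ hd hU
    (u := fun α => if ‖u α‖ = 1 then u α else 0) (fun α => by split_ifs with h <;> simp [h])
  have hy' : StrongLim J J₀ U (fun α => (S α).res (u α)) y :=
    hy.congr' (hu.mono fun α h => by simp only [if_pos h.1])
  have hpos : (1 + t₀) ≠ 0 := by positivity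
  have hc : Tendsto (fun α => ((-(1 + t α) : ℝ) : 𝕜)) U (𝓝 ((-(1 + t₀) : ℝ) : 𝕜)) :=
    (RCLike.continuous_ofReal.tendsto _).comp ((ht.const_add 1).neg)
  have hne : ∀ᶠ α in U, 1 + t α ≠ 0 := by
    filter_upwards [ht.eventually_const_lt (show -1 < t₀ by linarith)] with α hα
    linarith
  -- The eigenvalue equation reads u = -(1+t) R u, so strong convergence of R u carries over to u.
  have hw : StrongLim J J₀ U u (((-(1 + t₀) : ℝ) : 𝕜) • y) := by
    refine (hy'.smul hJU hc).congr' ?_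
    filter_upwards [hu, hne] with α h1 h2
    rw [(S α).res_of_mem_eigenspace h1.2, smul_neg, smul_smul, ← RCLike.ofReal_mul, neg_mul,
      mul_inv_cancel₀ h2]
    simp
  refine ⟨_, hw, ?_⟩
  have h3 := hR.strong_of_le hε hε0 hJ hd (fun α x => (S α).norm_res_le x) hU hw
  have h4 := h3.unique hJU hy'
  have h5 := S₀.mem_eigenspace_of_res (μ := (1 + t₀)⁻¹) (inv_ne_zero hpos)
    (x := ((-(1 + t₀) : ℝ) : 𝕜) • y) (by
      rw [h4, smul_smul, ← RCLike.ofReal_mul, mul_neg, inv_mul_cancel₀ hpos]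
      simp)
  rwa [inv_inv, add_sub_cancel_left] at h5

/-- The limit resolvent is bounded by limits of eigenvalues on the orthogonal complement of the
limits of the first eigenvectors. -/
theorem norm_res_le_of_limit [NeBot F] {ε : ι → ℝ} (hε : ∀ α, 0 < ε α)
    (hε0 : Tendsto ε F (𝓝 0)) (hJ : ∀ v, Tendsto (fun α => ‖J α v‖) F (𝓝 ‖J₀ v‖))
    (hd : DenseRange J₀) {S : ∀ α, SpectralStructure 𝕜 (E α)} {S₀ : SpectralStructure 𝕜 H}
    (hR : CompactLim J J₀ F (fun α => (S α).res) S₀.res) (hU : (U : Filter ι) ≤ F)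
    {φ : ∀ α, ℕ → E α} (hφ : ∀ α, IsOrthonormalEigenbasis (S α).A (φ α)) {φ₀ : ℕ → H} {k : ℕ}
    (hφ₀ : ∀ j, 1 ≤ j → j < k → StrongLim J J₀ U (fun α => φ α j) (φ₀ j))
    (hdim : ∀ j, 1 ≤ j → j < k → ∀ᶠ α in U, j ∈ dimIndices 𝕜 (E α))
    {B : ℝ} (hB : 0 ≤ B) (hk : ∀ᶠ α in U, (B : EReal) ≤ kthEigenvalue (S α).A k) {w : H}
    (hw : ∀ j, 1 ≤ j → j < k → inner 𝕜 (φ₀ j) w = (0 : 𝕜)) :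
    ‖S₀.res w‖ ≤ (1 + B)⁻¹ * ‖w‖ := by
  have hJU := fun v => (hJ v).mono_left hU
  obtain ⟨s, hs⟩ := exists_strongLim hε hε0 hJ hd w
  have hsU := hs.mono hU
  -- The lift of `w` is made orthogonal to the first eigenvectors; the correction tends to 0 because
  -- its coefficients tend to `⟪φ₀ j, w⟫ = 0`.
  have hx : StrongLim J J₀ U (fun α => s α - ∑ j ∈ Finset.Ico 1 k,
      (inner 𝕜 (φ α j) (s α) : 𝕜) • φ α j) w := by
    have h1 := hsU.sub (StrongLim.sum (Finset.Ico 1 k) fun j hj => by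
      have hj' := Finset.mem_Ico.1 hj
      have h2 := hφ₀ j hj'.1 hj'.2
      exact h2.smul hJU (h2.tendsto_inner hJU hsU))
    rwa [Finset.sum_eq_zero, sub_zero] at h1
    intro j hj
    have hj' := Finset.mem_Ico.1 hj
    rw [hw j hj'.1 hj'.2, zero_smul]
  have hRx := hR.strong_of_le hε hε0 hJ hd (fun α x => (S α).norm_res_le x) hU hx
  refine le_of_tendsto_of_tendsto (hRx.tendsto_norm hJU)
    ((hx.tendsto_norm hJU).const_mul (1 + B)⁻¹) ?_
  have hdim' : ∀ᶠ α in U, ∀ j ∈ Finset.Ico 1 k, j ∈ dimIndices 𝕜 (E α) :=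
    (Finset.eventually_all _).2 fun j hj =>
      hdim j (Finset.mem_Ico.1 hj).1 (Finset.mem_Ico.1 hj).2
  filter_upwards [hk, hdim'] with α h1 h2
  refine (S α).norm_res_le_of_orthogonal (hφ α) hB h1 fun j hj hjk => ?_
  have hjI : j ∈ Finset.Ico 1 k := Finset.mem_Ico.2 ⟨hj.1, hjk⟩
  have ho := (hφ α).1
  rw [inner_sub_right, inner_sum, Finset.sum_eq_single j, inner_smul_right,
    inner_self_eq_norm_sq_to_K, ho.1 ⟨j, hj⟩]
  · simp
  · intro i hi hij
    have h3 : (inner 𝕜 (φ α j) (φ α i) : 𝕜) = 0 := by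
      refine ho.2 (i := ⟨j, hj⟩) (j := ⟨i, h2 i hi⟩) fun h => hij ?_
      exact (congrArg Subtype.val h).symm
    rw [inner_smul_right, h3, mul_zero]
  · intro h
    exact absurd hjI h

/-- Convergence of eigenvalues and eigenvectors along an ultrafilter. -/
theorem exists_limit_eigenbasis [SecondCountableTopology H] [NeBot F] {ε : ι → ℝ}
    (hε : ∀ α, 0 < ε α)
    (hε0 : Tendsto ε F (𝓝 0)) (hJ : ∀ v, Tendsto (fun α => ‖J α v‖) F (𝓝 ‖J₀ v‖))
    (hd : DenseRange J₀) {S : ∀ α, SpectralStructure 𝕜 (E α)} {S₀ : SpectralStructure 𝕜 H}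
    (hR : CompactLim J J₀ F (fun α => (S α).res) S₀.res) (hU : (U : Filter ι) ≤ F)
    {φ : ∀ α, ℕ → E α} (hφ : ∀ α, IsOrthonormalEigenbasis (S α).A (φ α)) :
    ∃ φ₀ : ℕ → H, IsOrthonormalEigenbasis S₀.A φ₀ ∧
      (∀ k, 1 ≤ k → Tendsto (fun α => kthEigenvalue (S α).A k) U (𝓝 (kthEigenvalue S₀.A k))) ∧
      ∀ k ∈ dimIndices 𝕜 H, StrongLim J J₀ U (fun α => φ α k) (φ₀ k) := by
  have hJU := fun v => (hJ v).mono_left hU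
  have hΛ : ∀ k, ∃ a : EReal, Tendsto (fun α => kthEigenvalue (S α).A k) U (𝓝 a) := fun k => by
    obtain ⟨a, -, ha⟩ := isCompact_univ.ultrafilter_le_nhds
      (U.map fun α => kthEigenvalue (S α).A k) (by simp)
    exact ⟨a, ha⟩
  choose Λ hΛ using hΛ
  have hmono : Monotone Λ := fun j k hjk =>
    le_of_tendsto_of_tendsto' (hΛ j) (hΛ k) fun α => kthEigenvalue_mono _ hjk
  have hnn : ∀ k, 1 ≤ k → 0 ≤ Λ k := fun k hk =>
    ge_of_tendsto' (hΛ k) fun α => (S α).kthEigenvalue_nonneg hk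
  -- The indices with finite limit eigenvalue; they turn out to be `dimIndices 𝕜 H`.
  set K : Set ℕ := {k | 1 ≤ k ∧ Λ k < ⊤}
  have hKseg : ∀ k ∈ K, ∀ j, 1 ≤ j → j ≤ k → j ∈ K := fun k hk j hj hjk =>
    ⟨hj, (hmono hjk).trans_lt hk.2⟩
  have hcoe : ∀ k ∈ K, Λ k = ((Λ k).toReal : EReal) := fun k hk =>
    (EReal.coe_toReal hk.2.ne (by
      have := hnn k hk.1
      intro h
      rw [h] at this
      simp at this)).symm
  have hLnn : ∀ k ∈ K, 0 ≤ (Λ k).toReal := fun k hk => EReal.toReal_nonneg (hnn k hk.1)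
  have hdim : ∀ k ∈ K, ∀ᶠ α in U, k ∈ dimIndices 𝕜 (E α) := by
    intro k hk
    filter_upwards [(hΛ k).eventually_lt_const hk.2] with α hα
    exact mem_dimIndices_of_kthEigenvalue_lt_top hk.1 hα
  have hex : ∀ k, ∃ w : H, k ∈ K → StrongLim J J₀ U (fun α => φ α k) w ∧
      w ∈ eigenspace S₀.A (Λ k).toReal := by
    intro k
    by_cases hk : k ∈ K
    · have ht : Tendsto (fun α => (kthEigenvalue (S α).A k).toReal) U (𝓝 (Λ k).toReal) := by
        refine (EReal.tendsto_toReal hk.2.ne ?_).comp (hΛ k)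
        rw [hcoe k hk]
        exact EReal.coe_ne_bot _
      obtain ⟨w, hw⟩ := exists_limit_eigenvector hε hε0 hJ hd hR hU ht (hLnn k hk)
        (u := fun α => φ α k) (by
          filter_upwards [hdim k hk] with α hα
          obtain ⟨t, h1, h2⟩ := (hφ α).2.2 k hα
          refine ⟨(hφ α).1.1 ⟨k, hα⟩, ?_⟩
          rwa [h1, EReal.toReal_coe])
      exact ⟨w, fun _ => hw⟩
    · exact ⟨0, fun h => absurd h hk⟩
  choose φ₀ hφ₀ using hex
  have hinner : ∀ j ∈ K, ∀ k ∈ K, inner 𝕜 (φ₀ j) (φ₀ k) = if j = k then (1 : 𝕜) else 0 := by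
    intro j hj k hk
    refine tendsto_nhds_unique ((hφ₀ j hj).1.tendsto_inner hJU (hφ₀ k hk).1)
      (tendsto_const_nhds.congr' ?_)
    filter_upwards [hdim j hj, hdim k hk] with α h1 h2
    have := orthonormal_iff_ite.1 (hφ α).1 ⟨j, h1⟩ ⟨k, h2⟩
    simp only [Subtype.mk.injEq] at this
    rw [this]
  have ho : Orthonormal 𝕜 (fun k : K => φ₀ k) := by
    classical
    refine orthonormal_iff_ite.2 fun j k => ?_
    rw [hinner j j.2 k k.2]
    simp [Subtype.ext_iff]
  have hbound : ∀ k, (∀ j, 1 ≤ j → j < k → j ∈ K) → ∀ B : ℝ, 0 ≤ B → (B : EReal) < Λ k →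
      ∀ w : H, (∀ j ∈ K, inner 𝕜 (φ₀ j) w = (0 : 𝕜)) → ‖S₀.res w‖ ≤ (1 + B)⁻¹ * ‖w‖ := by
    intro k hk B hB hBk w hw
    exact norm_res_le_of_limit hε hε0 hJ hd hR hU hφ (φ₀ := φ₀)
      (fun j h1 h2 => (hφ₀ j (hk j h1 h2)).1) (fun j h1 h2 => hdim j (hk j h1 h2)) hB
      (((hΛ k).eventually_const_lt hBk).mono fun _ h => h.le) fun j h1 h2 => hw j (hk j h1 h2)
  -- the limit eigenvalues are unbounded
  have hunb : ∀ B : ℝ, ∃ k, (∀ j, 1 ≤ j → j < k → j ∈ K) ∧ (B : EReal) < Λ k := by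
    intro B
    by_cases hall : ∀ j, 1 ≤ j → j ∈ K
    -- An infinite orthonormal sequence is weakly null by Bessel, but bounded eigenvalues would keep
    -- its images under the resolvent away from 0.
    · by_contra! hcon
      obtain ⟨e, he0, he1, he⟩ := exists_orthogonal_sequence 𝕜 H
      have hmem : ∀ n : ℕ, n + 1 ∈ K := fun n => hall _ (by omega)
      have ho' : Orthonormal 𝕜 (fun n : ℕ => φ₀ (n + 1)) :=
        ho.comp (fun n : ℕ => (⟨n + 1, hmem n⟩ : K)) fun m n h => by simpa using h
      have h0 : Tendsto (fun n : ℕ => ‖S₀.res (φ₀ (n + 1))‖) atTop (𝓝 0) := by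
        refine hR.tendsto_zero_of_weak hε hε0 hJ hd he0 he1 he (B := 1)
          (Eventually.of_forall fun n => (ho'.1 n).le) fun l => ?_
        have h1 := (ho'.inner_products_summable (e l)).tendsto_atTop_zero
        rw [tendsto_zero_iff_norm_tendsto_zero]
        simp only [norm_inner_symm (e l)]
        simpa using h1.sqrt
      have h2 : ∀ n : ℕ, (1 + |B|)⁻¹ ≤ ‖S₀.res (φ₀ (n + 1))‖ := by
        intro n
        have h3 := hLnn _ (hmem n)
        have h4 : (Λ (n + 1)).toReal ≤ B := by
          have h5 := hcon (n + 1) fun j hj _ => hall j hj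
          rw [hcoe _ (hmem n)] at h5
          exact_mod_cast h5
        have h8 : 0 ≤ (1 + (Λ (n + 1)).toReal)⁻¹ := inv_nonneg.2 (by linarith)
        rw [S₀.res_of_mem_eigenspace (hφ₀ _ (hmem n)).2, norm_neg, norm_smul, ho'.1 n, mul_one,
          RCLike.norm_ofReal, abs_of_nonneg h8]
        exact inv_anti₀ (by linarith) (by linarith [le_abs_self B])
      have h6 : (1 + |B|)⁻¹ ≤ (0 : ℝ) := ge_of_tendsto' h0 h2
      have h7 : (0 : ℝ) < (1 + |B|)⁻¹ := by positivity
      linarith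
    · classical
      -- The first index outside `K` has limit eigenvalue +∞, and all smaller ones are in `K`.
      push Not at hall
      refine ⟨Nat.find hall, fun j h1 h2 => ?_, ?_⟩
      · by_contra h
        exact Nat.find_min hall h2 ⟨h1, h⟩
      · have h1 := Nat.find_spec hall
        have h2 : Λ (Nat.find hall) = ⊤ := by
          by_contra h
          exact h1.2 ⟨h1.1, lt_top_iff_ne_top.2 h⟩
        rw [h2]
        exact EReal.coe_lt_top _
  have hcomplete : (Submodule.span 𝕜 (φ₀ '' K)).topologicalClosure = ⊤ := by
    rw [Submodule.topologicalClosure_eq_top_iff, Submodule.eq_bot_iff]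
    intro w hw
    have hw' : ∀ j ∈ K, inner 𝕜 (φ₀ j) w = (0 : 𝕜) := fun j hj =>
      (Submodule.mem_orthogonal _ _).1 hw _ (Submodule.subset_span ⟨j, hj, rfl⟩)
    refine S₀.res_eq_zero (norm_le_zero_iff.1 ?_)
    have h1 : ∀ n : ℕ, ‖S₀.res w‖ ≤ (1 / ((n : ℝ) + 1)) * ‖w‖ := by
      intro n
      obtain ⟨k, hk, hkn⟩ := hunb n
      have h2 := hbound k hk n (Nat.cast_nonneg n) hkn w hw'
      rwa [add_comm, inv_eq_one_div] at h2
    have h3 : Tendsto (fun n : ℕ => (1 / ((n : ℝ) + 1)) * ‖w‖) atTop (𝓝 (0 * ‖w‖)) :=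
      tendsto_one_div_add_atTop_nhds_zero_nat.mul_const _
    rw [zero_mul] at h3
    exact ge_of_tendsto' h3 h1
  obtain ⟨h1, h2, h3, h4⟩ := S₀.eigenbasis_of_monotone (K := K) (fun k hk => hk.1) hKseg ho
    hcomplete (t := fun k => (Λ k).toReal) (fun j hj k hk hjk => by
      have h := hmono hjk
      rw [hcoe j hj, hcoe k hk] at h
      exact_mod_cast h) fun k hk => (hφ₀ k hk).2
  refine ⟨φ₀, h2, fun k hk => ?_, fun k hk => ?_⟩
  · by_cases hkK : k ∈ K
    · rw [h3 k hkK, ← hcoe k hkK]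
      exact hΛ k
    · rw [h4 k hk hkK]
      have h5 : Λ k = ⊤ := by
        by_contra h
        exact hkK ⟨hk, lt_top_iff_ne_top.2 h⟩
      rw [← h5]
      exact hΛ k
  · rw [h1] at hk
    exact (hφ₀ k hk).1

end Limit

/-! ### Comparison maps from continuous functions -/

section Comparison

variable {𝕜 : Type*} [RCLike 𝕜] {X : Type*} [MeasurableSpace X] {Y : Type*} [MetricSpace Y]
  [CompactSpace Y] [MeasurableSpace Y] [BorelSpace Y] {m : Measure X} [IsFiniteMeasure m]
  {f : X → Y}

theorem memLp_comp (hf : AEMeasurable f m) (v : C(Y, 𝕜)) : MemLp (fun x => v (f x)) 2 m :=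
  MemLp.of_bound (v.continuous.measurable.comp_aemeasurable hf).aestronglyMeasurable ‖v‖
    (Eventually.of_forall fun x => v.norm_coe_le_norm (f x))

/-- The map `v ↦ v ∘ f` from continuous functions to `L²`. -/
noncomputable def compLp (hf : AEMeasurable f m) : C(Y, 𝕜) →ₗ[𝕜] Lp 𝕜 2 m where
  toFun v := (memLp_comp hf v).toLp _
  map_add' _ _ := rfl
  map_smul' _ _ := rfl

theorem compLp_ae (hf : AEMeasurable f m) (v : C(Y, 𝕜)) :
    compLp hf v =ᵐ[m] fun x => v (f x) := (memLp_comp hf v).coeFn_toLp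

theorem eLpNorm_comp_sub (hf : AEMeasurable f m) (v : C(Y, 𝕜)) (u : Lp 𝕜 2 m) :
    eLpNorm (fun x => v (f x) - u x) 2 m = ENNReal.ofReal ‖compLp hf v - u‖ := by
  rw [Lp.norm_def, ENNReal.ofReal_toReal (Lp.eLpNorm_ne_top _)]
  refine eLpNorm_congr_ae ?_
  filter_upwards [compLp_ae hf v, Lp.coeFn_sub (compLp hf v) u] with x h1 h2
  rw [h2, Pi.sub_apply, h1]

theorem norm_compLp_sq (hf : AEMeasurable f m) (v : C(Y, 𝕜)) :
    ‖compLp hf v‖ ^ 2 = ∫ x, ‖v (f x)‖ ^ 2 ∂m := by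
  rw [@norm_sq_eq_re_inner 𝕜, L2.inner_def]
  have h : ∫ x, inner 𝕜 (compLp hf v x) (compLp hf v x) ∂m =
      ∫ x, ((‖v (f x)‖ ^ 2 : ℝ) : 𝕜) ∂m := by
    refine integral_congr_ae ?_
    filter_upwards [compLp_ae hf v] with x h1
    rw [h1, inner_self_eq_norm_sq_to_K, RCLike.ofReal_pow]
  rw [h, integral_ofReal, RCLike.ofReal_re]

theorem denseRange_compLp_id (m₀ : Measure Y) [IsFiniteMeasure m₀] :
    DenseRange (compLp (𝕜 := 𝕜) (aemeasurable_id : AEMeasurable id m₀)) := by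
  have h := ContinuousMap.toLp_denseRange 𝕜 m₀ 𝕜 (p := 2) (by norm_num)
  convert h using 1
  funext v
  exact Lp.ext ((compLp_ae aemeasurable_id v).trans (ContinuousMap.coeFn_toLp m₀ v).symm)

end Comparison

/-! ### Translation of the convergence notions on L² spaces -/

section Nets

variable {𝕜 : Type*} [RCLike 𝕜] {ι : Type*} [Preorder ι] {X : ι → Type*}
  [∀ α, MeasurableSpace (X α)] {Y : Type*} [MetricSpace Y] [CompactSpace Y] [MeasurableSpace Y]
  [BorelSpace Y] {m : ∀ α, Measure (X α)} [∀ α, IsFiniteMeasure (m α)] {m₀ : Measure Y}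
  [IsFiniteMeasure m₀] {f : ∀ α, X α → Y}

/-- The auxiliary net of continuous functions amounts to one function for each tolerance;
conversely, the tolerances 1/(n+1) provide a sequence. -/
theorem stronglyConverges_iff (hf : ∀ α, AEMeasurable (f α) (m α)) {u : ∀ α, Lp 𝕜 2 (m α)}
    {w : Lp 𝕜 2 m₀} : StronglyConverges f u w ↔
      StrongLim (fun α => compLp (hf α)) (compLp aemeasurable_id) atTop u w := by
  have h0 : ∀ v : C(Y, 𝕜), eLpNorm (fun y => v y - w y) 2 m₀ =
      ENNReal.ofReal ‖compLp aemeasurable_id v - w‖ := fun v =>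
    eLpNorm_comp_sub (f := id) aemeasurable_id v w
  constructor
  · rintro ⟨κ, _, _, _, v, h1, h2⟩ δ hδ
    have hδ' : 0 < ENNReal.ofReal δ := ENNReal.ofReal_pos.2 hδ
    obtain ⟨β, h3, h4⟩ := ((h1.eventually_lt_const hδ').and (h2.eventually_lt_const hδ')).exists
    refine ⟨v β, ?_, ?_⟩
    · rw [h0] at h3
      exact (ENNReal.ofReal_lt_ofReal_iff hδ).1 h3
    · filter_upwards [eventually_lt_of_limsup_lt h4] with α h5
      rw [eLpNorm_comp_sub (hf α)] at h5
      exact (ENNReal.ofReal_lt_ofReal_iff hδ).1 h5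
  · intro h
    choose v hv1 hv2 using fun n : ℕ => h (1 / ((n : ℝ) + 1)) (by positivity)
    have hz : Tendsto (fun n : ℕ => ENNReal.ofReal (1 / ((n : ℝ) + 1))) atTop (𝓝 0) := by
      simpa using ENNReal.tendsto_ofReal (tendsto_one_div_add_atTop_nhds_zero_nat (𝕜 := ℝ))
    refine ⟨ℕ, inferInstance, inferInstance, inferInstance, v, ?_, ?_⟩
    · refine tendsto_of_tendsto_of_tendsto_of_le_of_le tendsto_const_nhds hz
        (fun _ => zero_le) fun n => ?_
      simp only [h0]
      exact ENNReal.ofReal_le_ofReal (hv1 n).le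
    · refine tendsto_of_tendsto_of_tendsto_of_le_of_le tendsto_const_nhds hz
        (fun _ => zero_le) fun n => ?_
      refine limsup_le_of_le (by isBoundedDefault) ?_
      filter_upwards [hv2 n] with α hα
      rw [eLpNorm_comp_sub (hf α)]
      exact ENNReal.ofReal_le_ofReal hα.le

/-- Squared norms are integrals of the continuous function ‖v‖², so convergence of the measures
applies. -/
theorem MeasuredGHConverges.tendsto_norm [∀ α, MetricSpace (X α)]
    (h : MeasuredGHConverges m m₀ f) (v : C(Y, 𝕜)) :
    Tendsto (fun α => ‖compLp (h.2.1 α) v‖) atTop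
      (𝓝 ‖compLp (m := m₀) aemeasurable_id v‖) := by
  have h1 := h.2.2 ⟨fun y => ‖v y‖ ^ 2, by fun_prop⟩
  have h2 : ∀ x : ℝ, 0 ≤ x → √(x ^ 2) = x := fun x hx => Real.sqrt_sq hx
  have h3 := h1.sqrt
  simp only [ContinuousMap.coe_mk] at h3
  have h4 := norm_compLp_sq (m := m₀) (f := id) aemeasurable_id v
  simp only [id] at h4
  rw [← h4, h2 _ (norm_nonneg _)] at h3
  refine h3.congr fun α => ?_
  rw [← norm_compLp_sq (h.2.1 α), h2 _ (norm_nonneg _)]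

theorem CompactlyConverges.compactLim (hf : ∀ α, AEMeasurable (f α) (m α))
    {B : ∀ α, Lp 𝕜 2 (m α) →L[𝕜] Lp 𝕜 2 (m α)} {B₀ : Lp 𝕜 2 m₀ →L[𝕜] Lp 𝕜 2 m₀}
    (h : CompactlyConverges f B B₀) :
    CompactLim (fun α => compLp (hf α)) (compLp aemeasurable_id) atTop B B₀ := fun u w huw =>
  (stronglyConverges_iff hf).1 (h u w fun v z hv => huw v z ((stronglyConverges_iff hf).1 hv))

end Nets

/-- Every ultrafilter finer than `atTop` is the limit of a monotone subnet. -/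
theorem exists_subnet {ι : Type u} [Preorder ι] [IsDirectedOrder ι] [Nonempty ι]
    (U : Ultrafilter ι) (hU : (U : Filter ι) ≤ atTop) :
    ∃ (κ : Type u) (_ : Preorder κ) (_ : IsDirectedOrder κ) (_ : Nonempty κ) (h : κ → ι),
      Monotone h ∧ Tendsto h atTop U := by
  -- Pointed members of U, ordered by reverse inclusion and by the order of the points. The first
  -- gives convergence to U, the second monotonicity; directedness uses U ≤ `atTop`.
  let κ : Type u := {p : Set ι × ι // p.1 ∈ U ∧ p.2 ∈ p.1}
  let inst : Preorder κ :=
    { le := fun p q => q.1.1 ⊆ p.1.1 ∧ p.1.2 ≤ q.1.2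
      lt := fun p q => (q.1.1 ⊆ p.1.1 ∧ p.1.2 ≤ q.1.2) ∧ ¬(p.1.1 ⊆ q.1.1 ∧ q.1.2 ≤ p.1.2)
      le_refl := fun p => ⟨subset_rfl, le_rfl⟩
      le_trans := fun p q r h h' => ⟨h'.1.trans h.1, h.2.trans h'.2⟩ }
  have hne : Nonempty κ := ⟨⟨(Set.univ, Classical.arbitrary ι), univ_mem, Set.mem_univ _⟩⟩
  refine ⟨κ, inst, ⟨fun p q => ?_⟩, hne, fun p => p.1.2, fun p q h => h.2, fun s hs => ?_⟩
  · have h1 : p.1.1 ∩ q.1.1 ∈ U := inter_mem p.2.1 q.2.1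
    obtain ⟨a, ⟨ha1, ha2⟩, ha3⟩ := U.nonempty_of_mem
      (inter_mem h1 (hU (inter_mem (Ici_mem_atTop p.1.2) (Ici_mem_atTop q.1.2))))
    exact ⟨⟨(p.1.1 ∩ q.1.1, a), h1, ha1, ha2⟩, ⟨Set.inter_subset_left, ha3.1⟩,
      ⟨Set.inter_subset_right, ha3.2⟩⟩
  · obtain ⟨a, ha⟩ := U.nonempty_of_mem hs
    refine mem_map.2 (mem_of_superset (Ici_mem_atTop (⟨(s, a), hs, ha⟩ : κ)) fun p hp => ?_)
    exact hp.1 p.2.2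

end SpectralConvergence

theorem mainTheorem8 {𝕜 : Type*} [RCLike 𝕜]
    {ι : Type u} [Preorder ι] [IsDirectedOrder ι] [Nonempty ι]
    {X : ι → Type*} [∀ α, MetricSpace (X α)] [∀ α, CompactSpace (X α)]
    [∀ α, MeasurableSpace (X α)] [∀ α, BorelSpace (X α)]
    {Y : Type*} [MetricSpace Y] [CompactSpace Y] [MeasurableSpace Y] [BorelSpace Y]
    (m : ∀ α, Measure (X α)) [∀ α, IsFiniteMeasure (m α)]
    (m₀ : Measure Y) [IsFiniteMeasure m₀]
    (f : ∀ α, X α → Y) (hf : SpectralConvergence.MeasuredGHConverges m m₀ f)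
    (S : ∀ α, SpectralConvergence.SpectralStructure 𝕜 (Lp 𝕜 2 (m α)))
    (S₀ : SpectralConvergence.SpectralStructure 𝕜 (Lp 𝕜 2 m₀))
    (hS : SpectralConvergence.SpectralStructure.CompactlyConverges f S S₀)
    (hcompact : ∀ α, ∀ ζ ∈ SpectralConvergence.resolventSet (S α).A,
      IsCompactOperator (SpectralConvergence.resolvent (S α).A ζ)) :
    (∀ k : ℕ, 1 ≤ k →
      Tendsto (fun α => SpectralConvergence.kthEigenvalue (S α).A k) atTop
        (𝓝 (SpectralConvergence.kthEigenvalue S₀.A k))) ∧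
    ∀ φ : ∀ α, ℕ → Lp 𝕜 2 (m α),
      (∀ α, SpectralConvergence.IsOrthonormalEigenbasis (S α).A (φ α)) →
      ∃ (κ : Type u) (_ : Preorder κ) (_ : IsDirectedOrder κ) (_ : Nonempty κ) (h : κ → ι)
        (φ₀ : ℕ → Lp 𝕜 2 m₀),
        Monotone h ∧ Tendsto h atTop atTop ∧
        SpectralConvergence.IsOrthonormalEigenbasis S₀.A φ₀ ∧
        ∀ k ∈ SpectralConvergence.dimIndices 𝕜 (Lp 𝕜 2 m₀),
          SpectralConvergence.StronglyConverges (fun b => f (h b))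
            (fun b => φ (h b) k) (φ₀ k) := by
  obtain ⟨ε, hε, hε0, -⟩ := hf.1
  have hJ := fun v => hf.tendsto_norm (𝕜 := 𝕜) v
  have hd := SpectralConvergence.denseRange_compLp_id (𝕜 := 𝕜) m₀
  have hR := (hS (-1) S₀.neg_one_mem_resolventSet
    fun α => (S α).neg_one_mem_resolventSet).compactLim hf.2.1
  have : Fact ((2 : ℝ≥0∞) ≠ ∞) := ⟨by norm_num⟩
  -- Separability, due to `Y` being compact metric, supplies the orthogonal sequence.
  have : SecondCountableTopology (Lp 𝕜 2 m₀) := Lp.SecondCountableTopology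
  have key : ∀ (U : Ultrafilter ι), (U : Filter ι) ≤ atTop → ∀ φ : ∀ α, ℕ → Lp 𝕜 2 (m α),
      (∀ α, SpectralConvergence.IsOrthonormalEigenbasis (S α).A (φ α)) → _ := fun U hU φ hφ =>
    SpectralConvergence.exists_limit_eigenbasis hε hε0 hJ hd hR hU hφ
  refine ⟨fun k hk => ?_, fun φ hφ => ?_⟩
  · choose φ hφ using fun α => (S α).exists_eigenbasis
      (hcompact α (-1) (S α).neg_one_mem_resolventSet)
    -- Every finer ultrafilter gives the same limit, so no subnet is needed for the eigenvalues.
    rw [tendsto_iff_ultrafilter]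
    intro U hU
    obtain ⟨φ₀, -, h, -⟩ := key U hU φ hφ
    exact h k hk
  · have hU := Ultrafilter.of_le (atTop : Filter ι)
    obtain ⟨φ₀, h1, -, h2⟩ := key _ hU φ hφ
    obtain ⟨κ, i1, i2, i3, h, hmono, hh⟩ := SpectralConvergence.exists_subnet _ hU
    refine ⟨κ, i1, i2, i3, h, φ₀, hmono, hh.mono_right hU, h1, fun k hk => ?_⟩
    refine (SpectralConvergence.stronglyConverges_iff fun b => hf.2.1 (h b)).2 fun δ hδ => ?_
    obtain ⟨v, hv1, hv2⟩ := h2 k hk δ hδ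
    exact ⟨v, hv1, hh.eventually hv2⟩
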